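/- For a fusion ring $(R,\mathcal B)$ with standard basis $\mathcal B=\{x_i\}_{i\in I}$ and involution $x_i\mapsto x_i^*=x_{i^*}$, put $R_{\mathbb C}=R\otimes_{\mathbb Z}\mathbb C$, let $d_i=\mathrm{FPdim}(x_i)$ be the Frobenius–Perron dimension of $x_i$ and $\mathrm{FPdim}(R)=\sum_i d_i^2$. Let $\{x_i^\circ\}$ be the basis of the dual space $R_{\mathbb C}^*$ dual to $\{x_i\}$, and let $\mathcal F:R_{\mathbb C}\to R_{\mathbb C}^*$ be the linear map with $\mathcal F(x_i)=\mathrm{FPdim}(R)\,x_{i^*}^\circ$. For $\rho\in\mathrm{Irr}(R_{\mathbb C})$ (irreducible representations, identified with their characters) let $F^\rho\in R_{\mathbb C}$ be the corresponding primitive central idempotent and $S^\rho=\mathcal F(F^\rho)$. The *Isaacs terms* of $R$ are the numbers $$\tilde\omega_i(S^\rho)=\frac{S^\rho(x_i)}{d_i}\qquad(i\in I,\ \rho\in\mathrm{Irr}(R_{\mathbb C})),$$ and $R$ has the *Isaacs property* if all of them are algebraic integers. The Isaacs terms and the Isaacs property of a fusion category over $\mathbb C$ are those of its Grothendieck ring,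 whose standard basis consists of the classes of the simple objects. **Lemma 4.11.** Let $\mathcal C$ and $\mathcal D$ be spherical fusion categories over $\mathbb C$, with Grothendieck rings $R$ and $S$, and let $T$ be the Grothendieck ring of $\mathcal C\boxtimes\mathcal D$. Then the Isaacs terms of $\mathcal C\boxtimes\mathcal D$ are the products of the Isaacs terms of $\mathcal C$ and $\mathcal D$. More precisely, $(X,Y)\mapsto X\boxtimes Y$ induces a bijection from pairs of isomorphism classes of simple objects of $\mathcal C$ and $\mathcal D$ to isomorphism classes of simple objects of $\mathcal C\boxtimes\mathcal D$; there is a bijection $(\rho,\sigma)\mapsto\rho\boxtimes\sigma$ from $\mathrm{Irr}(R_{\mathbb C})\times\mathrm{Irr}(S_{\mathbb C})$ to $\mathrm{Irr}(T_{\mathbb C})$ with $(\rho\boxtimes\sigma)([X\boxtimes Y])=\rho([X])\,\sigma([Y])$; and the Isaacs term of $\mathcal C\boxtimes\mathcal D$ at $(X\boxtimes Y,\rho\boxtimes\sigma)$ is the product of the Isaacs term of $\mathcal C$ at $(X,\rho)$ and that of $\mathcal D$ at $(Y,\sigma)$. In particular the set of Isaacs terms of $\mathcal C\boxtimes\mathcal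 D$ is the set of products of an Isaacs term of $\mathcal C$ and one of $\mathcal D$, and if $\mathcal C$ and $\mathcal D$ have the Isaacs property, then so does $\mathcal C\boxtimes\mathcal D$. -/

import Mathlib

open CategoryTheory CategoryTheory.Limits CategoryTheory.MonoidalCategory
open scoped TensorProduct

universe v u u₁ u₂ u₃

/-! ### Irreducible characters and their central idempotents -/

section Algebra

variable (A : Type*) [Ring A] [Algebra ℂ A]

/-- An irreducible (nonzero, finite dimensional) matrix representation of a `ℂ`-algebra. -/
structure IrrRep where
  /-- the degree -/
  deg : ℕ
  deg_pos : 0 < deg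
  /-- the action -/
  toAlgHom : A →ₐ[ℂ] Matrix (Fin deg) (Fin deg) ℂ
  irreducible : ∀ W : Submodule ℂ (Fin deg → ℂ),
    (∀ a, ∀ w ∈ W, (toAlgHom a).mulVec w ∈ W) → W = ⊥ ∨ W = ⊤

variable {A}

/-- The character of a representation. -/
noncomputable def IrrRep.character (ρ : IrrRep A) : A →ₗ[ℂ] ℂ :=
  Matrix.traceLinearMap (Fin ρ.deg) ℂ ℂ ∘ₗ ρ.toAlgHom.toLinearMap

variable (A) in
/-- `Irr(A)`: irreducible representations of `A`, identified with their characters. -/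
def IrrChar : Type _ := {χ : A →ₗ[ℂ] ℂ // ∃ ρ : IrrRep A, ρ.character = χ}

/-- The value of an irreducible character. -/
def IrrChar.val (χ : IrrChar A) : A →ₗ[ℂ] ℂ := χ.1

/-- `e` is a primitive central idempotent: it is nonzero and the only central idempotents
below it are `0` and `e`. -/
structure IsPrimitiveCentralIdempotent (e : A) : Prop where
  central : ∀ a, e * a = a * e
  idem : e * e = e
  ne_zero : e ≠ 0
  primitive : ∀ f : A, (∀ a, f * a = a * f) → f * f = f → e * f = f → f = 0 ∨ f = e

theorem IrrRep.map_central_idem (ρ : IrrRep A) {e : A} (hc : ∀ a, e * a = a * e)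
    (hi : e * e = e) : ρ.toAlgHom e = 0 ∨ ρ.toAlgHom e = 1 := by
  rcases ρ.irreducible (LinearMap.range (Matrix.mulVecLin (ρ.toAlgHom e))) (by
    rintro a _ ⟨w, rfl⟩
    refine ⟨(ρ.toAlgHom a).mulVec w, ?_⟩
    simp only [Matrix.mulVecLin_apply, Matrix.mulVec_mulVec, ← map_mul, hc]) with h | h
  · left
    rw [LinearMap.range_eq_bot] at h
    ext i j
    have := congrFun (LinearMap.congr_fun h (Pi.single j 1)) i
    simpa using this
  · right
    rw [LinearMap.range_eq_top] at h
    ext i j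
    obtain ⟨w, hw⟩ := h (Pi.single j 1)
    have h2 : (ρ.toAlgHom e).mulVec (Pi.single j 1) = Pi.single j 1 := by
      rw [← hw, Matrix.mulVecLin_apply, Matrix.mulVec_mulVec, ← map_mul, hi]
    have := congrFun h2 i
    simpa [Matrix.one_apply, Pi.single_apply] using this

theorem IrrRep.character_ne_zero_iff (ρ : IrrRep A) {e : A} (hc : ∀ a, e * a = a * e)
    (hi : e * e = e) : ρ.character e ≠ 0 ↔ ρ.toAlgHom e = 1 := by
  have hd : (ρ.deg : ℂ) ≠ 0 := by exact_mod_cast ρ.deg_pos.ne'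
  have h1 : (1 : Matrix (Fin ρ.deg) (Fin ρ.deg) ℂ) ≠ 0 := by
    intro h
    have := congrArg Matrix.trace h
    simp [hd] at this
  rcases ρ.map_central_idem hc hi with h | h <;> simp [IrrRep.character, h, hd]
  exact fun h => h1 h.symm

/-- To an irreducible character of a finite dimensional algebra corresponds exactly one primitive
central idempotent on which it does not vanish. -/
theorem IrrChar.existsUnique_idempotent [Module.Finite ℂ A] (χ : IrrChar A) :
    ∃! e : A, IsPrimitiveCentralIdempotent e ∧ χ.val e ≠ 0 := by
  obtain ⟨χ, ρ, rfl⟩ := χ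
  change ∃! e : A, IsPrimitiveCentralIdempotent e ∧ ρ.character e ≠ 0
  have key : ∀ n : ℕ, ∀ e : A, Module.finrank ℂ (LinearMap.range (LinearMap.mulLeft ℂ e)) ≤ n →
      (∀ a, e * a = a * e) → e * e = e → ρ.character e ≠ 0 →
      ∃ f, IsPrimitiveCentralIdempotent f ∧ ρ.character f ≠ 0 := by
    intro n
    induction n with
    | zero =>
      intro e hn _ _ h0
      exfalso
      apply h0
      have h := Submodule.finrank_eq_zero.mp (Nat.le_zero.mp hn)
      rw [LinearMap.range_eq_bot] at h
      have : e = 0 := by simpa using LinearMap.congr_fun h 1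
      simp [this]
    | succ n ih =>
      intro e hn hc hi h0
      by_cases hp : IsPrimitiveCentralIdempotent e
      · exact ⟨e, hp, h0⟩
      have hne : e ≠ 0 := by rintro rfl; simp at h0
      have : ∃ f : A, (∀ a, f * a = a * f) ∧ f * f = f ∧ e * f = f ∧ f ≠ 0 ∧ f ≠ e := by
        by_contra hcon
        push Not at hcon
        refine hp ⟨hc, hi, hne, fun f h1 h2 h3 => ?_⟩
        by_cases hf : f = 0
        · exact Or.inl hf
        · exact Or.inr (hcon f h1 h2 h3 hf)
      have step : ∀ f : A, (∀ a, f * a = a * f) → f * f = f → e * f = f → f ≠ e →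
          ρ.character f ≠ 0 → ∃ f, IsPrimitiveCentralIdempotent f ∧ ρ.character f ≠ 0 := by
        intro f h1 h2 h3 h5 h6
        refine ih f ?_ h1 h2 h6
        have hlt : LinearMap.range (LinearMap.mulLeft ℂ f) <
            LinearMap.range (LinearMap.mulLeft ℂ e) := by
          refine lt_of_le_of_ne ?_ ?_
          · rintro _ ⟨a, rfl⟩
            exact ⟨f * a, by simp [← mul_assoc, h3]⟩
          · intro heq
            have : e ∈ LinearMap.range (LinearMap.mulLeft ℂ f) := by
              rw [heq]; exact ⟨1, by simp⟩
            obtain ⟨a, ha⟩ := this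
            apply h5
            simp only [LinearMap.mulLeft_apply] at ha
            rw [← h3, ← h1, ← ha, ← mul_assoc, h2]
        have := Submodule.finrank_lt_finrank_of_lt hlt
        omega
      obtain ⟨f, h1, h2, h3, h4, h5⟩ := this
      have h3' : f * e = f := by rw [h1, h3]
      by_cases h6 : ρ.character f = 0
      · refine step (e - f) (fun a => by rw [sub_mul, mul_sub, hc, h1]) ?_ ?_ ?_ ?_
        · simp [sub_mul, mul_sub, hi, h2, h3, h3']
        · simp [mul_sub, hi, h3]
        · simpa using h4
        · simpa [h6] using h0
      · exact step f h1 h2 h3 h5 h6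
  obtain ⟨e, he, h0⟩ := key _ 1 le_rfl (by simp) (by simp)
    ((ρ.character_ne_zero_iff (by simp) (by simp)).2 (map_one _))
  refine ⟨e, ⟨he, h0⟩, ?_⟩
  rintro f ⟨hf, hf0⟩
  have r1 := (ρ.character_ne_zero_iff he.central he.idem).1 h0
  have r2 := (ρ.character_ne_zero_iff hf.central hf.idem).1 hf0
  have hcef : ∀ a, (e * f) * a = a * (e * f) := fun a => by
    rw [mul_assoc, hf.central, ← mul_assoc, he.central, mul_assoc]
  have hief : (e * f) * (e * f) = e * f := by
    calc (e * f) * (e * f) = e * ((f * e) * f) := by simp only [mul_assoc]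
      _ = (e * e) * (f * f) := by rw [hf.central e]; simp only [mul_assoc]
      _ = e * f := by rw [he.idem, hf.idem]
  have hne : e * f ≠ 0 := by
    intro h
    have h' := (ρ.character_ne_zero_iff hcef hief).2 (by rw [map_mul, r1, r2, one_mul])
    simp [h] at h'
  have e1 := (he.primitive (e * f) hcef hief (by rw [← mul_assoc, he.idem])).resolve_left hne
  have e2 := (hf.primitive (e * f) hcef hief
    (by rw [he.central, ← mul_assoc, hf.idem])).resolve_left hne
  rw [← e1, e2]

/-- `F^ρ`: the primitive central idempotent corresponding to an irreducible character. -/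
noncomputable def IrrChar.idempotent [Module.Finite ℂ A] (χ : IrrChar A) : A :=
  χ.existsUnique_idempotent.choose

end Algebra

/-! ### Fusion rings -/

open Classical in
/-- A fusion ring structure on a `*`-ring `R`: a finite `ℤ`-basis indexed by `ι` that contains `1`
and is stable under `*`, with nonnegative structure constants `N_{ij}^k` and
`N_{ij}^0 = δ_{i, j*}`. -/
structure FusionRing (ι R : Type*) [Fintype ι] [Ring R] [StarRing R] where
  /-- the standard basis -/
  basis : Module.Basis ι ℤ R
  /-- the index of the unit -/
  unit : ι
  /-- the duality `i ↦ i*` -/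
  dual : ι → ι
  basis_unit : basis unit = 1
  basis_dual : ∀ i, basis (dual i) = star (basis i)
  nonneg : ∀ i j k, 0 ≤ basis.repr (basis i * basis j) k
  repr_unit : ∀ i j, basis.repr (basis i * basis j) unit = if i = dual j then 1 else 0

namespace FusionRing

variable {ι R : Type*} [Fintype ι] [Ring R] [StarRing R] (F : FusionRing ι R)

/-- The structure constants `N_{ij}^k`. -/
noncomputable def N (i j k : ι) : ℤ := F.basis.repr (F.basis i * F.basis j) k

open Classical in
/-- The Frobenius-Perron dimension `d_i` of the basis element `x_i`: the spectral radius of its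
fusion matrix (by the Perron-Frobenius theorem, its largest nonnegative eigenvalue). -/
noncomputable def fpdim (i : ι) : ℝ :=
  (spectralRadius ℂ (Matrix.of fun j k => (F.N i j k : ℂ))).toReal

/-- The Frobenius-Perron dimension of the fusion ring. -/
noncomputable def FPdim : ℝ := ∑ i, F.fpdim i ^ 2

/-- The standard basis, as a basis of the complexification `R_ℂ`. -/
noncomputable def basisC : Module.Basis ι ℂ (ℂ ⊗[ℤ] R) := F.basis.baseChange ℂ

theorem finite_complexification {ι R : Type*} [Fintype ι] [Ring R] [StarRing R]
    (F : FusionRing ι R) : Module.Finite ℂ (ℂ ⊗[ℤ] R) := Module.Finite.of_basis F.basisC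

/-- The Fourier transform `R_ℂ → R_ℂ^*`, `x_i ↦ FPdim(R) x_{i*}°`, where `x_i°` is the basis
dual to `x_i`. -/
noncomputable def fourier : (ℂ ⊗[ℤ] R) →ₗ[ℂ] Module.Dual ℂ (ℂ ⊗[ℤ] R) :=
  F.basisC.constr ℂ fun i => (F.FPdim : ℂ) • F.basisC.coord (F.dual i)

/-- The linear character `ω̃_i : μ ↦ μ(x_i) / d_i` of the dual. -/
noncomputable def omega (i : ι) (μ : Module.Dual ℂ (ℂ ⊗[ℤ] R)) : ℂ :=
  μ (F.basisC i) / (F.fpdim i : ℂ)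

/-- The matrix class sum `S^ρ`: the Fourier transform of the primitive central idempotent of `ρ`. -/
noncomputable def classSum (ρ : IrrChar (ℂ ⊗[ℤ] R)) : Module.Dual ℂ (ℂ ⊗[ℤ] R) :=
  haveI := F.finite_complexification
  F.fourier ρ.idempotent

/-- The Isaacs term `ω̃_i(S^ρ)`. -/
noncomputable def isaacsTerm (i : ι) (ρ : IrrChar (ℂ ⊗[ℤ] R)) : ℂ := F.omega i (F.classSum ρ)

/-- The set of Isaacs terms. -/
def isaacsTerms : Set ℂ := {t | ∃ i ρ, F.isaacsTerm i ρ = t}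

/-- The Isaacs property: all Isaacs terms are algebraic integers. -/
def IsIsaacs : Prop := ∀ i ρ, IsIntegral ℤ (F.isaacsTerm i ρ)

end FusionRing

/-! ### Fusion categories -/

section Category

set_option linter.unusedSectionVars false
set_option linter.style.haveILetI false

attribute [local instance] Abelian.hasFiniteBiproducts

variable (C : Type u) [Category.{v} C] [Abelian C] [Linear ℂ C] [MonoidalCategory C]
  [MonoidalPreadditive C] [MonoidalLinear ℂ C] [RigidCategory C]

/-- Isomorphism of simple objects. -/
def simpleSetoid (C : Type u) [Category.{v} C] [HasZeroMorphisms C] :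
    Setoid {X : C // Simple X} where
  r X Y := Nonempty (X.1 ≅ Y.1)
  iseqv := ⟨fun _ => ⟨Iso.refl _⟩, fun ⟨e⟩ => ⟨e.symm⟩, fun ⟨e⟩ ⟨f⟩ => ⟨e.trans f⟩⟩

/-- `Irr(C)`: isomorphism classes of simple objects. -/
def Irr (C : Type u) [Category.{v} C] [HasZeroMorphisms C] : Type u := Quotient (simpleSetoid C)

/-- The class of a simple object. -/
def Irr.mk {C : Type u} [Category.{v} C] [HasZeroMorphisms C] (X : C) [h : Simple X] : Irr C :=
  Quotient.mk (simpleSetoid C) ⟨X, h⟩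

/-- A representative of a class of simple objects. -/
noncomputable def Irr.rep {C : Type u} [Category.{v} C] [HasZeroMorphisms C] (i : Irr C) : C :=
  (Quotient.out i).1

/-- A fusion category over `ℂ`: a `ℂ`-linear abelian rigid monoidal category with bilinear tensor
product and finite dimensional morphism spaces, which is semisimple with finitely many simple
objects up to isomorphism and whose unit object is simple. -/
class FusionCategory : Prop where
  finiteDimensional_hom : ∀ X Y : C, FiniteDimensional ℂ (X ⟶ Y)
  semisimple : ∀ X : C, ∃ (n : ℕ) (S : Fin n → C), (∀ i, Simple (S i)) ∧ Nonempty (X ≅ ⨁ S)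
  finite_irr : Finite (Irr C)
  simple_unit : Simple (𝟙_ C)

/-- A pivotal structure: a monoidal natural isomorphism `j_X : X ≅ X**`, where `(X ⊗ Y)**` is
identified with `X** ⊗ Y**` in the canonical way. -/
class PivotalCategory (C : Type u) [Category.{v} C] [MonoidalCategory C] [RigidCategory C] where
  /-- the isomorphism with the double dual -/
  j : ∀ X : C, X ≅ (Xᘁ : C)ᘁ
  naturality : ∀ {X Y : C} (f : X ⟶ Y), f ≫ (j Y).hom = (j X).hom ≫ (fᘁ)ᘁ
  tensor : ∀ X Y : C, (j (X ⊗ Y)).hom =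
    ((j X).hom ⊗ₘ (j Y).hom) ≫ (rightDualTensorIso Yᘁ Xᘁ).inv ≫ ((rightDualTensorIso X Y).hom)ᘁ

/-- The categorical dimension of an object for a pivotal structure, as an endomorphism of `𝟙`. -/
def PivotalCategory.dim {C : Type u} [Category.{v} C] [MonoidalCategory C] [RigidCategory C]
    [PivotalCategory C] (X : C) : 𝟙_ C ⟶ 𝟙_ C :=
  η_ X Xᘁ ≫ (PivotalCategory.j X).hom ▷ Xᘁ ≫ ε_ Xᘁ ((Xᘁ : C)ᘁ)

/-- A pivotal category is spherical if every object has the same dimension as its dual. -/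
class SphericalCategory (C : Type u) [Category.{v} C] [MonoidalCategory C] [RigidCategory C]
    extends PivotalCategory C where
  dim_dual : ∀ X : C, PivotalCategory.dim Xᘁ = PivotalCategory.dim X

/-- The Grothendieck ring `K₀(C)` of a fusion category: the free abelian group on the finite set
`Irr(C)` of isomorphism classes of simple objects, an element being given by its coefficients. -/
@[ext]
structure K0 (C : Type u) [Category.{v} C] [HasZeroMorphisms C] where
  /-- the coefficients with respect to the classes of the simple objects -/
  coeff : Irr C → ℤ

namespace FusionCategory

/-- The dimension of a morphism space. -/
noncomputable def hd {C : Type u} [Category.{v} C] [Abelian C] [Linear ℂ C] (X Y : C) : ℤ :=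
  (Module.finrank ℂ (X ⟶ Y) : ℤ)

variable {C}

theorem hd_congr_right (X : C) {Y Y' : C} (e : Y ≅ Y') : hd X Y = hd X Y' := by
  unfold hd
  rw [LinearEquiv.finrank_eq (LinearEquiv.ofBijective (Linear.rightComp ℂ X e.hom)
    ⟨fun f g h => by simpa using h, fun f => ⟨f ≫ e.inv, by simp⟩⟩)]

theorem hd_congr_left {X X' : C} (e : X ≅ X') (Y : C) : hd X Y = hd X' Y := by
  unfold hd
  rw [LinearEquiv.finrank_eq (LinearEquiv.ofBijective (Linear.leftComp ℂ Y e.inv)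
    ⟨fun f g h => by simpa using h, fun f => ⟨e.hom ≫ f, by simp⟩⟩)]

theorem hd_congr {X X' Y Y' : C} (e : X ≅ X') (f : Y ≅ Y') : hd X Y = hd X' Y' :=
  (hd_congr_left e Y).trans (hd_congr_right X' f)

variable [FusionCategory C]

instance (X Y : C) : FiniteDimensional ℂ (X ⟶ Y) := finiteDimensional_hom X Y

instance : Simple (𝟙_ C) := simple_unit

noncomputable instance : Fintype (Irr C) :=
  haveI : Finite (Irr C) := finite_irr
  Fintype.ofFinite _

theorem hd_biproduct_right {n : ℕ} (X : C) (S : Fin n → C) :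
    hd X (⨁ S) = ∑ k, hd X (S k) := by
  have e : (X ⟶ ⨁ S) ≃ₗ[ℂ] (∀ k, X ⟶ S k) :=
    LinearEquiv.ofBijective
      (LinearMap.pi fun k => Linear.rightComp ℂ X (biproduct.π S k))
      ⟨fun f g h => biproduct.hom_ext _ _ fun k => by simpa using congrFun h k,
        fun f => ⟨biproduct.lift f, by ext k; simp⟩⟩
  unfold hd
  rw [e.finrank_eq, Module.finrank_pi_fintype]
  push_cast
  rfl

theorem hd_biproduct_left {n : ℕ} (S : Fin n → C) (Y : C) :
    hd (⨁ S) Y = ∑ k, hd (S k) Y := by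
  have e : (⨁ S ⟶ Y) ≃ₗ[ℂ] (∀ k, S k ⟶ Y) :=
    LinearEquiv.ofBijective
      (LinearMap.pi fun k => Linear.leftComp ℂ Y (biproduct.ι S k))
      ⟨fun f g h => biproduct.hom_ext' _ _ fun k => by simpa using congrFun h k,
        fun f => ⟨biproduct.desc f, by ext k; simp⟩⟩
  unfold hd
  rw [e.finrank_eq, Module.finrank_pi_fintype]
  push_cast
  rfl

open Classical in
theorem hd_simple (X Y : C) [Simple X] [Simple Y] :
    hd X Y = if Nonempty (X ≅ Y) then 1 else 0 := by
  unfold hd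
  rw [finrank_hom_simple_simple ℂ X Y]
  split_ifs <;> rfl

theorem hd_symm (X Y : C) : hd X Y = hd Y X := by
  classical
  obtain ⟨n, S, hS, ⟨e⟩⟩ := semisimple X
  obtain ⟨m, T, hT, ⟨f⟩⟩ := semisimple Y
  rw [hd_congr e f, hd_congr f e, hd_biproduct_left, hd_biproduct_left]
  simp_rw [hd_biproduct_right]
  rw [Finset.sum_comm]
  refine Finset.sum_congr rfl fun j _ => Finset.sum_congr rfl fun i _ => ?_
  haveI := hS i
  haveI := hT j
  rw [hd_simple, hd_simple]
  exact if_congr ⟨fun ⟨e⟩ => ⟨e.symm⟩, fun ⟨e⟩ => ⟨e.symm⟩⟩ rfl rfl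

/-- An object with one dimensional endomorphism space is simple. -/
theorem simple_of_hd {X : C} (h : hd X X = 1) : Simple X := by
  classical
  obtain ⟨n, S, hS, ⟨e⟩⟩ := semisimple X
  have h1 : hd X X = ∑ i, ∑ j, hd (S i) (S j) := by
    rw [hd_congr e e, hd_biproduct_left]
    simp_rw [hd_biproduct_right]
  have hle : (n : ℤ) ≤ ∑ i, ∑ j, hd (S i) (S j) := by
    calc (n : ℤ) = ∑ i : Fin n, 1 := by simp
      _ ≤ _ := Finset.sum_le_sum fun i _ => by
        haveI := hS i
        have h2 : hd (S i) (S i) = 1 := by rw [hd_simple, if_pos ⟨Iso.refl _⟩]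
        rw [← h2]
        exact Finset.single_le_sum (f := fun j => hd (S i) (S j))
          (fun j _ => Int.natCast_nonneg _) (Finset.mem_univ i)
  have hn : n = 1 := by
    rcases n with _ | _ | n
    · simp [h] at h1
    · rfl
    · push_cast at hle; omega
  subst hn
  haveI := hS 0
  exact Simple.of_iso (e.trans (biproductUniqueIso S))

instance (i : Irr C) : Simple i.rep := (Quotient.out i).2

theorem mk_rep (i : Irr C) : Irr.mk i.rep = i := Quotient.out_eq i

theorem mk_eq_iff (X Y : C) [hX : Simple X] [hY : Simple Y] :
    Irr.mk X = Irr.mk Y ↔ Nonempty (X ≅ Y) :=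
  Quotient.eq (r := simpleSetoid C) (x := ⟨X, hX⟩) (y := ⟨Y, hY⟩)

theorem rep_mk_iso (X : C) [Simple X] : Nonempty ((Irr.mk X).rep ≅ X) := by
  rw [← mk_eq_iff, mk_rep]

open Classical in
theorem hd_rep_simple (i : Irr C) (X : C) [Simple X] :
    hd i.rep X = if i = Irr.mk X then 1 else 0 := by
  rw [hd_simple]
  exact if_congr (by rw [← mk_eq_iff, mk_rep]) rfl rfl

/-- Decomposition of additive invariants along the simple constituents. -/
theorem additive_eq_sum (φ : C → ℤ) (hiso : ∀ X Y, (X ≅ Y) → φ X = φ Y)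
    (hsum : ∀ (n : ℕ) (S : Fin n → C), φ (⨁ S) = ∑ k, φ (S k)) (X : C) :
    φ X = ∑ i : Irr C, hd i.rep X * φ i.rep := by
  classical
  obtain ⟨n, S, hS, ⟨e⟩⟩ := semisimple X
  rw [hiso _ _ e, hsum]
  simp_rw [hd_congr_right _ e, hd_biproduct_right, Finset.sum_mul]
  rw [Finset.sum_comm]
  refine Finset.sum_congr rfl fun k _ => ?_
  haveI := hS k
  simp only [hd_rep_simple, ite_mul, one_mul, zero_mul, Finset.sum_ite_eq',
    Finset.mem_univ, if_true]
  obtain ⟨f⟩ := rep_mk_iso (S k)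
  exact hiso _ _ f.symm

/-- The multiplicity of the `k`-th simple object in the tensor product of the `i`-th and `j`-th. -/
noncomputable def mult (i j k : Irr C) : ℤ := hd k.rep (i.rep ⊗ j.rep)

theorem sum_mult_left (i j k l : Irr C) :
    ∑ e, mult i j e * mult e k l = hd l.rep ((i.rep ⊗ j.rep) ⊗ k.rep) :=
  (additive_eq_sum (fun Y => hd l.rep (Y ⊗ k.rep))
    (fun _ _ e => hd_congr_right _ (whiskerRightIso e _))
    (fun n S => by
      rw [hd_congr_right _ (rightDistributor S k.rep), hd_biproduct_right]) _).symm

theorem sum_mult_right (i j k l : Irr C) :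
    ∑ e, mult j k e * mult i e l = hd l.rep (i.rep ⊗ (j.rep ⊗ k.rep)) :=
  (additive_eq_sum (fun Y => hd l.rep (i.rep ⊗ Y))
    (fun _ _ e => hd_congr_right _ (whiskerLeftIso _ e))
    (fun n S => by
      rw [hd_congr_right _ (leftDistributor i.rep S), hd_biproduct_right]) _).symm

theorem mult_assoc (i j k l : Irr C) :
    ∑ e, mult i j e * mult e k l = ∑ e, mult j k e * mult i e l := by
  rw [sum_mult_left, sum_mult_right]
  exact hd_congr_right _ (α_ _ _ _)

open Classical in
theorem unit_mult (j k : Irr C) : mult (Irr.mk (𝟙_ C)) j k = if k = j then 1 else 0 := by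
  obtain ⟨e⟩ := rep_mk_iso (𝟙_ C)
  rw [mult, hd_congr_right _ (whiskerRightIso e j.rep ≪≫ λ_ j.rep), hd_rep_simple, mk_rep]

open Classical in
theorem mult_unit (j k : Irr C) : mult j (Irr.mk (𝟙_ C)) k = if k = j then 1 else 0 := by
  obtain ⟨e⟩ := rep_mk_iso (𝟙_ C)
  rw [mult, hd_congr_right _ (whiskerLeftIso j.rep e ≪≫ ρ_ j.rep), hd_rep_simple, mk_rep]

theorem hd_tensorLeft (X Y Y' Z : C) [ExactPairing Y Y'] : hd (Y' ⊗ X) Z = hd X (Y ⊗ Z) := by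
  unfold hd
  have e : (Y' ⊗ X ⟶ Z) ≃ₗ[ℂ] (X ⟶ Y ⊗ Z) :=
    { tensorLeftHomEquiv X Y Y' Z with
      map_add' := fun f g => by simp [tensorLeftHomEquiv]
      map_smul' := fun r f => by simp [tensorLeftHomEquiv] }
  rw [e.finrank_eq]

theorem hd_tensorRight (X Y Y' Z : C) [ExactPairing Y Y'] : hd (X ⊗ Y) Z = hd X (Z ⊗ Y') := by
  unfold hd
  have e : (X ⊗ Y ⟶ Z) ≃ₗ[ℂ] (X ⟶ Z ⊗ Y') :=
    { tensorRightHomEquiv X Y Y' Z with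
      map_add' := fun f g => by simp [tensorRightHomEquiv]
      map_smul' := fun r f => by simp [tensorRightHomEquiv] }
  rw [e.finrank_eq]

theorem hd_dual (X Y : C) : hd Xᘁ Yᘁ = hd Y X := by
  rw [hd_congr_left (ρ_ Xᘁ).symm, hd_tensorLeft _ X, ← hd_tensorRight _ Y, hd_congr_left (λ_ Y)]

instance simple_dual (X : C) [Simple X] : Simple Xᘁ :=
  simple_of_hd (by rw [hd_dual]; classical rw [hd_simple, if_pos ⟨Iso.refl _⟩])

/-- The class of the dual of a simple object. -/
noncomputable def dual (i : Irr C) : Irr C := Irr.mk (i.rep)ᘁ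

open Classical in
theorem hd_unit_tensor (X Y : C) [Simple X] [Simple Y] :
    hd (𝟙_ C) (X ⊗ Y) = if Nonempty (Xᘁ ≅ Y) then 1 else 0 := by
  rw [← hd_tensorLeft _ X Xᘁ, hd_congr_left (ρ_ Xᘁ), hd_simple]

open Classical in
theorem hd_unit_tensor' (X Y : C) [Simple X] [Simple Y] :
    hd (𝟙_ C) (X ⊗ Y) = if Nonempty (X ≅ Yᘁ) then 1 else 0 := by
  rw [hd_symm, hd_tensorRight _ Y Yᘁ, hd_congr_right _ (λ_ Yᘁ), hd_simple]

theorem dual_eq_iff (X Y : C) [Simple X] [Simple Y] : Nonempty (Xᘁ ≅ Y) ↔ Nonempty (X ≅ Yᘁ) := by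
  classical
  have h := (hd_unit_tensor X Y).symm.trans (hd_unit_tensor' X Y)
  by_cases h1 : Nonempty (Xᘁ ≅ Y) <;> by_cases h2 : Nonempty (X ≅ Yᘁ)
  · exact iff_of_true h1 h2
  · rw [if_pos h1, if_neg h2] at h
    exact absurd h one_ne_zero
  · rw [if_neg h1, if_pos h2] at h
    exact absurd h zero_ne_one
  · exact iff_of_false h1 h2

theorem dual_dual (i : Irr C) : dual (dual i) = i := by
  obtain ⟨e⟩ := rep_mk_iso (i.rep)ᘁ
  obtain ⟨f⟩ := (dual_eq_iff i.rep (dual i).rep).1 ⟨e.symm⟩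
  conv_rhs => rw [← mk_rep i]
  exact (mk_eq_iff _ _).2 ⟨f.symm⟩

open Classical in
theorem mult_to_unit (i j : Irr C) :
    mult i j (Irr.mk (𝟙_ C)) = if i = dual j then 1 else 0 := by
  obtain ⟨e⟩ := rep_mk_iso (𝟙_ C)
  rw [mult, hd_congr_left e, hd_unit_tensor']
  exact if_congr (by rw [← mk_eq_iff, mk_rep]; rfl) rfl rfl

theorem mult_dual (i j k : Irr C) : mult (dual j) (dual i) (dual k) = mult i j k := by
  obtain ⟨a⟩ := rep_mk_iso (i.rep)ᘁ
  obtain ⟨b⟩ := rep_mk_iso (j.rep)ᘁ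
  obtain ⟨c⟩ := rep_mk_iso (k.rep)ᘁ
  have h : mult (dual j) (dual i) (dual k) = hd (k.rep)ᘁ (i.rep ⊗ j.rep)ᘁ :=
    hd_congr c ((tensorIso b a).trans (rightDualTensorIso i.rep j.rep).symm)
  rw [h, hd_dual, hd_symm, mult]

end FusionCategory

namespace K0

open FusionCategory

variable {C} [FusionCategory C]

/-- Coordinates on `K₀(C)`. -/
def equiv : K0 C ≃ (Irr C → ℤ) := ⟨coeff, mk, fun _ => rfl, fun _ => rfl⟩

instance : AddCommGroup (K0 C) := equiv.addCommGroup

theorem add_coeff (a b : K0 C) (k : Irr C) : (a + b).coeff k = a.coeff k + b.coeff k := rfl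

theorem zero_coeff (k : Irr C) : (0 : K0 C).coeff k = 0 := rfl

/-- The product of `K₀(C)`: `[X_i] [X_j] = ∑_k N_{ij}^k [X_k]`, where `N_{ij}^k` is the multiplicity
of `X_k` in `X_i ⊗ X_j`. -/
noncomputable instance : Mul (K0 C) :=
  ⟨fun a b => ⟨fun k => ∑ i, ∑ j, a.coeff i * b.coeff j * mult i j k⟩⟩

theorem mul_coeff (a b : K0 C) (k : Irr C) :
    (a * b).coeff k = ∑ i, ∑ j, a.coeff i * b.coeff j * mult i j k := rfl

open Classical in
/-- The unit of `K₀(C)` is the class of the unit object. -/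
noncomputable instance : One (K0 C) := ⟨⟨fun k => if k = Irr.mk (𝟙_ C) then 1 else 0⟩⟩

open Classical in
theorem one_coeff (k : Irr C) :
    (1 : K0 C).coeff k = if k = Irr.mk (𝟙_ C) then 1 else 0 := rfl

noncomputable instance : Ring (K0 C) :=
  { (inferInstance : AddCommGroup (K0 C)), (inferInstance : Mul (K0 C)),
    (inferInstance : One (K0 C)) with
    left_distrib := fun a b c => by
      ext k; simp [mul_coeff, add_coeff, mul_add, add_mul, Finset.sum_add_distrib]
    right_distrib := fun a b c => by
      ext k; simp [mul_coeff, add_coeff, add_mul, Finset.sum_add_distrib]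
    zero_mul := fun a => by ext k; simp [mul_coeff, zero_coeff]
    mul_zero := fun a => by ext k; simp [mul_coeff, zero_coeff]
    one_mul := fun a => by
      classical
      ext k
      simp only [mul_coeff, one_coeff, ite_mul, one_mul, zero_mul]
      rw [Finset.sum_comm]
      simp [unit_mult]
    mul_one := fun a => by
      classical
      ext k
      simp [mul_coeff, one_coeff, mult_unit]
    mul_assoc := fun a b c => by
      ext l
      have h1 : (a * b * c).coeff l =
          ∑ i, ∑ j, ∑ k, a.coeff i * b.coeff j * c.coeff k * ∑ e, mult i j e * mult e k l := by
        simp only [mul_coeff, Finset.sum_mul, Finset.mul_sum]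
        rw [Finset.sum_congr rfl fun e _ => Finset.sum_comm, Finset.sum_comm]
        refine Finset.sum_congr rfl fun i _ => ?_
        rw [Finset.sum_congr rfl fun e _ => Finset.sum_comm, Finset.sum_comm]
        refine Finset.sum_congr rfl fun j _ => ?_
        rw [Finset.sum_comm]
        exact Finset.sum_congr rfl fun k _ => Finset.sum_congr rfl fun e _ => by ring
      have h2 : (a * (b * c)).coeff l =
          ∑ i, ∑ j, ∑ k, a.coeff i * b.coeff j * c.coeff k * ∑ e, mult j k e * mult i e l := by
        simp only [mul_coeff, Finset.sum_mul, Finset.mul_sum]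
        refine Finset.sum_congr rfl fun i _ => ?_
        rw [Finset.sum_comm]
        refine Finset.sum_congr rfl fun j _ => ?_
        rw [Finset.sum_comm]
        exact Finset.sum_congr rfl fun k _ => Finset.sum_congr rfl fun e _ => by ring
      rw [h1, h2]
      simp_rw [mult_assoc] }

noncomputable instance : StarRing (K0 C) where
  star a := ⟨fun i => a.coeff (dual i)⟩
  star_involutive a := by
    ext i
    exact congrArg a.coeff (dual_dual i)
  star_mul a b := by
    ext k
    change (a * b).coeff (dual k) = ∑ i, ∑ j, b.coeff (dual i) * a.coeff (dual j) * mult i j k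
    rw [mul_coeff, Finset.sum_comm]
    have hd : Function.Involutive (dual : Irr C → Irr C) := dual_dual
    rw [← Equiv.sum_comp hd.toPerm]
    refine Finset.sum_congr rfl fun i _ => ?_
    rw [← Equiv.sum_comp hd.toPerm]
    refine Finset.sum_congr rfl fun j _ => ?_
    simp only [Function.Involutive.coe_toPerm]
    rw [mult_dual]
    ring
  star_add a b := rfl

/-- Coordinates on `K₀(C)`, as an additive isomorphism. -/
def coords : K0 C ≃+ (Irr C → ℤ) := { equiv with map_add' := fun _ _ => rfl }

/-- The standard basis of `K₀(C)`: the classes `[X_i]` of the simple objects. -/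
noncomputable def basis : Module.Basis (Irr C) ℤ (K0 C) :=
  Module.Basis.ofEquivFun coords.toIntLinearEquiv

theorem basis_repr (a : K0 C) (k : Irr C) : basis.repr a k = a.coeff k := rfl

open Classical in
theorem basis_apply (i k : Irr C) : (basis i).coeff k = if k = i then 1 else 0 := by
  rw [← basis_repr, Module.Basis.repr_self, Finsupp.single_apply]
  exact if_congr eq_comm rfl rfl

theorem basis_mul_basis (i j k : Irr C) : (basis i * basis j).coeff k = mult i j k := by
  classical
  simp [mul_coeff, basis_apply]

open Classical in
/-- The Grothendieck ring of a fusion category is a fusion ring whose standard basis consists of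
the classes of the simple objects. -/
noncomputable def fusionRing (C : Type u) [Category.{v} C] [Abelian C] [Linear ℂ C]
    [MonoidalCategory C] [MonoidalPreadditive C] [MonoidalLinear ℂ C] [RigidCategory C]
    [FusionCategory C] : FusionRing (Irr C) (K0 C) where
  basis := basis
  unit := Irr.mk (𝟙_ C)
  dual := dual
  basis_unit := by
    ext k
    rw [basis_apply, one_coeff]
  basis_dual i := by
    ext k
    change _ = (basis i).coeff (dual k)
    rw [basis_apply, basis_apply]
    refine if_congr ⟨?_, ?_⟩ rfl rfl
    · rintro rfl
      exact dual_dual i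
    · rintro rfl
      exact (dual_dual k).symm
  nonneg i j k := by
    rw [basis_repr, basis_mul_basis]
    exact Int.natCast_nonneg _
  repr_unit i j := by
    rw [basis_repr, basis_mul_basis, mult_to_unit]

end K0

/-! ### The Deligne tensor product -/

section Deligne

variable {C : Type u₁} [Category.{v} C] [Abelian C] [Linear ℂ C]
  {D : Type u₂} [Category.{v} D] [Abelian D] [Linear ℂ D]

/-- A bifunctor is `ℂ`-bilinear and right exact in each variable. -/
structure IsBilinearRightExact {A : Type u} [Category.{v} A] [Abelian A] [Linear ℂ A]
    (F : C × D ⥤ A) : Prop where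
  additive_left : ∀ Y, (Prod.sectL C Y ⋙ F).Additive
  linear_left : ∀ Y, (Prod.sectL C Y ⋙ F).Linear ℂ
  rightExact_left : ∀ Y, PreservesFiniteColimits (Prod.sectL C Y ⋙ F)
  additive_right : ∀ X, (Prod.sectR X D ⋙ F).Additive
  linear_right : ∀ X, (Prod.sectR X D ⋙ F).Linear ℂ
  rightExact_right : ∀ X, PreservesFiniteColimits (Prod.sectR X D ⋙ F)

/-- A functor is `ℂ`-linear and right exact. -/
structure IsLinearRightExact {E : Type u₃} [Category.{v} E] [Abelian E] [Linear ℂ E]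
    {A : Type u} [Category.{v} A] [Abelian A] [Linear ℂ A] (G : E ⥤ A) : Prop where
  additive : G.Additive
  linear : G.Linear ℂ
  rightExact : PreservesFiniteColimits G

/-- `B : C × D ⥤ E` exhibits `E` as the Deligne tensor product `C ⊠ D`: it is the universal
`ℂ`-bilinear bifunctor, right exact in each variable, i.e. for every `ℂ`-linear abelian category `A`
composition with `B` is an equivalence from `ℂ`-linear right exact functors `E ⥤ A` to `ℂ`-bilinear
bifunctors `C × D ⥤ A` right exact in each variable. (The categories `A` are the large ones whose
morphism spaces lie in the universe of those of `C`, `D` and `E`; up to equivalence, all categories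
small in that universe are among them.) The usual monoidal structure of `C ⊠ D`, for which
`(X ⊠ Y) ⊗ (X' ⊠ Y') ≅ (X ⊗ X') ⊠ (Y ⊗ Y')`, is expressed by `B` being a monoidal functor. -/
structure IsDeligneTensorProduct {E : Type u₃} [Category.{v} E] [Abelian E] [Linear ℂ E]
    (B : C × D ⥤ E) : Prop where
  bilinear : IsBilinearRightExact B
  exists_lift : ∀ (A : Type (v + 1)) [LargeCategory A] [Abelian A] [Linear ℂ A] (F : C × D ⥤ A),
    IsBilinearRightExact F → ∃ G : E ⥤ A, IsLinearRightExact G ∧ Nonempty (B ⋙ G ≅ F)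
  existsUnique_hom : ∀ (A : Type (v + 1)) [LargeCategory A] [Abelian A] [Linear ℂ A]
    (G G' : E ⥤ A), IsLinearRightExact G → IsLinearRightExact G' →
    ∀ α : B ⋙ G ⟶ B ⋙ G', ∃! β : G ⟶ G', Functor.whiskerLeft B β = α

end Deligne

end Category

/-! The proof has a ring-theoretic half and a categorical half, which meet in
`FusionRing.IsProduct`: the basis of `T` is indexed by pairs, and its structure constants are
products of those of `R` and `S`.

Ring half. The Isaacs term at `(i, ρ)` is `FPdim(R)` times the coefficient of `F^ρ` at `x_{i*}`,
divided by `d_i`, so it suffices that each ingredient is multiplicative. The fusion matrix of a pair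
is a Kronecker product. By Gelfand's formula, spectral radii multiply under Kronecker products,
hence so do `d_i` and `FPdim`. A complexified fusion ring is semisimple, because for the Hermitian
form with orthonormal standard basis the adjoint of left multiplication by `x_i` is left
multiplication by `x_{i*}`. So `R_ℂ` and `S_ℂ` are products of matrix algebras, and the blocks of
`T_ℂ ≅ R_ℂ ⊗ S_ℂ` are the Kronecker products of their blocks. Irreducible characters correspond to
blocks, so they are indexed by pairs: their values multiply, and the central idempotent of a pair is
`F^ρ ⊗ F^σ`. Integrality of the terms follows because algebraic integers are closed under products.

Categorical half. Only the universal property of `⊠` is available. Every object of a fusion category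
is projective, so additive functors out of it are right exact and the functors used as tests are
admissible. Extending `Hom(X, -) ⊗ Hom(Y, -)` to `E` and comparing it with `Hom(X ⊠ Y, -)` yields
`dim Hom(X ⊠ Y, X' ⊠ Y') ≤ dim Hom(X, X') · dim Hom(Y, Y')` (`hd_obj_le`). This bound, together with
`X ⊠ Y ≠ 0`, makes `X ⊠ Y` simple for simple `X`, `Y` and separates distinct pairs. A simple `Z` not
of this form would have `Hom(Z, -)` zero on every `X ⊠ Y`; uniqueness of extensions then forces `𝟙_Z
= 0`. Monoidality of `B` turns this bijection into the product formula for multiplicities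
(`isProduct`). -/

open scoped Kronecker CategoryTheory.Prod

set_option linter.unusedSectionVars false

/-! ### Irreducible characters of products of matrix algebras -/

namespace BlockDecomposition

open Matrix

variable {A : Type*} [Ring A] [Algebra ℂ A] {I : Type*} [Fintype I] [DecidableEq I]
  {n : I → Type*} [∀ i, Fintype (n i)] [∀ i, DecidableEq (n i)] [∀ i, Nonempty (n i)]
  (Φ : A ≃ₐ[ℂ] ∀ i, Matrix (n i) (n i) ℂ)

/-- The irreducible representation on the `i`-th block. -/
noncomputable def rep (i : I) : IrrRep A where
  deg := Fintype.card (n i)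
  deg_pos := Fintype.card_pos
  toAlgHom := ((Matrix.reindexAlgEquiv ℂ ℂ (Fintype.equivFin (n i))).toAlgHom.comp
    (Pi.evalAlgHom ℂ _ i)).comp Φ.toAlgHom
  irreducible W hW := by
    by_cases h : W = ⊥
    · exact Or.inl h
    · right
      obtain ⟨w, hw, hw0⟩ := W.ne_bot_iff.1 h
      obtain ⟨j, hj⟩ := Function.ne_iff.1 hw0
      have key : ∀ k, Pi.single k (1 : ℂ) ∈ W := by
        intro k
        -- The matrix unit `e_{kj}` sends `w` to `w_j e_k`, so a nonzero coordinate of `w` produces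
        -- every standard basis vector.
        have := W.smul_mem (w j)⁻¹ (hW (Φ.symm (Pi.single i ((Matrix.reindexAlgEquiv ℂ ℂ
          (Fintype.equivFin (n i))).symm (Matrix.single k j 1)))) w hw)
        convert this using 1
        simp only [AlgHom.comp_apply, AlgEquiv.coe_toAlgHom, AlgEquiv.apply_symm_apply,
          Pi.evalAlgHom_apply, Pi.single_eq_same]
        ext l
        simp only [Pi.smul_apply, smul_eq_mul, Matrix.single_mulVec, Function.update_apply, Pi.single_apply]
        simp only [Pi.zero_apply] at hj
        split_ifs <;> simp [hj]
      rw [eq_top_iff]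
      rintro x -
      rw [pi_eq_sum_univ x]
      refine W.sum_mem fun k _ => W.smul_mem _ ?_
      convert key k using 1
      ext l
      simp [Pi.single_apply, eq_comm]

/-- The irreducible character of the `i`-th block. -/
noncomputable def char (i : I) : IrrChar A := ⟨(rep Φ i).character, rep Φ i, rfl⟩

theorem char_val (i : I) (a : A) : (char Φ i).val a = (Φ a i).trace := by
  exact Equiv.sum_comp (Fintype.equivFin (n i)).symm fun j => Φ a i j j

/-- The central idempotent of the `i`-th block. -/
noncomputable def idem (i : I) : A := Φ.symm (Pi.single i 1)

theorem idem_central (i : I) (a : A) : idem Φ i * a = a * idem Φ i := by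
  apply Φ.injective
  ext1 j
  by_cases h : j = i
  · subst h; simp [idem]
  · simp [idem, Pi.single_eq_of_ne h]

theorem idem_idem (i : I) : idem Φ i * idem Φ i = idem Φ i := by
  apply Φ.injective
  simp [idem, ← Pi.single_mul]

theorem sum_idem : ∑ i, idem Φ i = 1 := by
  apply Φ.injective
  simp only [idem, map_sum, AlgEquiv.apply_symm_apply, map_one]
  exact Finset.univ_sum_single (1 : ∀ i, Matrix (n i) (n i) ℂ)

/-- A central idempotent below the block idempotent lives in the `i`-th block alone, and there
irreducibility makes it `0` or `1`. -/
theorem idem_primitive (i : I) : IsPrimitiveCentralIdempotent (idem Φ i) where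
  central := idem_central Φ i
  idem := idem_idem Φ i
  ne_zero h := by
    have := congrFun (congrArg Φ h) i
    simp [idem] at this
  primitive f hc hi hf := by
    have h0 : ∀ j, j ≠ i → Φ f j = 0 := fun j hj => by
      rw [← hf]; simp [idem, Pi.single_eq_of_ne hj]
    refine ((rep Φ i).map_central_idem hc hi).imp (fun h => ?_) fun h => ?_
    · apply Φ.injective
      ext1 j
      by_cases hj : j = i
      · subst hj
        have : Matrix.reindexAlgEquiv ℂ ℂ (Fintype.equivFin (n j)) (Φ f j) = 0 := h
        rw [map_zero]
        exact (map_eq_zero_iff _ (AlgEquiv.injective _)).1 this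
      · simp [h0 j hj]
    · apply Φ.injective
      ext1 j
      by_cases hj : j = i
      · subst hj
        have : Matrix.reindexAlgEquiv ℂ ℂ (Fintype.equivFin (n j)) (Φ f j) = 1 := h
        rw [idem, AlgEquiv.apply_symm_apply, Pi.single_eq_same]
        exact (map_eq_one_iff _ (AlgEquiv.injective _)).1 this
      · simp [h0 j hj, idem, Pi.single_eq_of_ne hj]

theorem char_idem (i j : I) :
    (char Φ i).val (idem Φ j) = if i = j then (Fintype.card (n i) : ℂ) else 0 := by
  rw [char_val]
  split_ifs with h
  · subst h; simp [idem]
  · simp [idem, Pi.single_eq_of_ne h]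

theorem char_idempotent [Module.Finite ℂ A] (i : I) : (char Φ i).idempotent = idem Φ i := by
  have h := (char Φ i).existsUnique_idempotent
  refine h.unique h.choose_spec.1 ⟨idem_primitive Φ i, ?_⟩
  rw [char_idem, if_pos rfl]
  exact_mod_cast Fintype.card_ne_zero

theorem char_injective : Function.Injective (char Φ) := by
  intro i j h
  by_contra hij
  have h1 := char_idem Φ i i
  rw [h, char_idem, if_neg (Ne.symm hij), if_pos rfl] at h1
  exact Fintype.card_ne_zero (by exact_mod_cast h1.symm)

/-- Each block idempotent acts as `0` or `1`; since they sum to `1` and the representation is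
nonzero, they cannot all act as `0`. -/
theorem exists_map_idem_eq_one (ρ : IrrRep A) : ∃ i, ρ.toAlgHom (idem Φ i) = 1 := by
  by_contra! h
  have h0 : ∀ i, ρ.toAlgHom (idem Φ i) = 0 := fun i =>
    (ρ.map_central_idem (idem_central Φ i) (idem_idem Φ i)).resolve_right (h i)
  have := congrArg ρ.toAlgHom (sum_idem Φ)
  rw [map_sum, Finset.sum_congr rfl fun i _ => h0 i, Finset.sum_const_zero, map_one] at this
  have h1 := congrFun (congrFun this ⟨0, ρ.deg_pos⟩) ⟨0, ρ.deg_pos⟩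
  simp at h1

end BlockDecomposition

/-- A trace form on a matrix algebra is a multiple of the trace. -/
theorem Matrix.linear_eq_mul_trace {m : Type*} [Fintype m] [DecidableEq m] (f : Matrix m m ℂ →ₗ[ℂ] ℂ)
    (hf : ∀ M N, f (M * N) = f (N * M)) (j₀ : m) (M : Matrix m m ℂ) :
    f M = f (Matrix.single j₀ j₀ 1) * M.trace := by
  -- Swapping factors turns `e_{j j₀} e_{j₀ j} = e_{jj}` into `e_{j₀ j₀}`, and turns `e_{jj} e_{jk}
  -- = e_{jk}` into `0` when `j ≠ k`.
  have h1 : ∀ j k, f (Matrix.single j k 1) = if j = k then f (Matrix.single j₀ j₀ 1) else 0 := by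
    intro j k
    split_ifs with h
    · subst h
      have := hf (Matrix.single j j₀ 1) (Matrix.single j₀ j 1)
      simpa using this
    · have := hf (Matrix.single j j 1) (Matrix.single j k 1)
      rw [Matrix.single_mul_single_of_ne _ _ _ _ (Ne.symm h)] at this
      simpa using this
  have h2 : ∀ j k, f (Matrix.single j k (M j k)) = M j k * f (Matrix.single j k 1) := by
    intro j k
    rw [← smul_eq_mul, ← map_smul, Matrix.smul_single]
    simp
  conv_lhs => rw [Matrix.matrix_eq_sum_single M]
  rw [Matrix.trace, Finset.mul_sum, map_sum]
  refine Finset.sum_congr rfl fun j _ => ?_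
  rw [map_sum, Finset.sum_congr rfl fun k _ => (h2 j k).trans (congrArg _ (h1 j k))]
  simp only [mul_ite, mul_zero, Finset.sum_ite_eq, Finset.mem_univ, if_true]
  exact mul_comm _ _

namespace BlockDecomposition

open Matrix

variable {A : Type*} [Ring A] [Algebra ℂ A] {I : Type*} [Fintype I] [DecidableEq I]
  {n : I → Type*} [∀ i, Fintype (n i)] [∀ i, DecidableEq (n i)] [∀ i, Nonempty (n i)]
  (Φ : A ≃ₐ[ℂ] ∀ i, Matrix (n i) (n i) ℂ)

/-- An irreducible representation factors through the one block whose idempotent acts as `1`. An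
explicit intertwiner from column vectors shows that its degree is the size of that block. Its trace
is a trace form on the block, hence a multiple of the matrix trace, and evaluation at `1` shows that
the multiple is `1`. -/
theorem char_surjective : Function.Surjective (char Φ) := by
  rintro ⟨_, ρ, rfl⟩
  obtain ⟨i, hi⟩ := exists_map_idem_eq_one Φ ρ
  refine ⟨i, Subtype.ext (LinearMap.ext fun a => ?_)⟩
  change (char Φ i).val a = ρ.character a
  rw [char_val]
  let τ : Matrix (n i) (n i) ℂ →ₗ[ℂ] Matrix (Fin ρ.deg) (Fin ρ.deg) ℂ :=
    ρ.toAlgHom.toLinearMap ∘ₗ Φ.symm.toLinearMap ∘ₗ LinearMap.single ℂ (fun i => Matrix (n i) (n i) ℂ) i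
  have τ_apply : ∀ M, τ M = ρ.toAlgHom (Φ.symm (Pi.single i M)) := fun M => rfl
  have τ_mul : ∀ M N, τ (M * N) = τ M * τ N := fun M N => by
    rw [τ_apply, Pi.single_mul, map_mul, map_mul]; rfl
  have τ_one : τ 1 = 1 := hi
  have τ_comp : ∀ b, ρ.toAlgHom b = τ (Φ b i) := fun b => by
    rw [← one_mul (ρ.toAlgHom b), ← hi, ← map_mul, τ_apply]
    congr 1
    apply Φ.injective
    ext1 j
    by_cases h : j = i
    · subst h; simp [idem]
    · simp [idem, Pi.single_eq_of_ne h]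
  obtain ⟨j₀⟩ : Nonempty (n i) := inferInstance
  -- Otherwise the trace form `tr ∘ τ` would vanish identically, while at `1` it equals the positive
  -- degree of `ρ`.
  have hE : τ (Matrix.single j₀ j₀ 1) ≠ 0 := by
    intro h
    have h1 : ∀ M, (Matrix.traceLinearMap _ ℂ ℂ ∘ₗ τ) M = 0 := fun M => by
      rw [Matrix.linear_eq_mul_trace (Matrix.traceLinearMap _ ℂ ℂ ∘ₗ τ)
        (fun M N => by simp [τ_mul, Matrix.trace_mul_comm (τ M)]) j₀ M]
      simp [h]
    have := h1 1
    simp [τ_one, ρ.deg_pos.ne'] at this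
  obtain ⟨w₀, hw₀⟩ : ∃ w₀, (τ (Matrix.single j₀ j₀ 1)).mulVec w₀ ≠ 0 := by
    by_contra! h
    exact hE (Matrix.ext_of_mulVec_single fun k => by rw [h, Matrix.zero_mulVec])
  -- Matrices supported in column `j₀` form a left ideal isomorphic to the column representation;
  -- acting with them on `w₀` gives the intertwiner.
  let L : (n i → ℂ) →ₗ[ℂ] (Fin ρ.deg → ℂ) :=
    { toFun := fun v => (τ (∑ k, v k • Matrix.single k j₀ 1)).mulVec w₀
      map_add' := fun v w => by
        simp [add_smul, Finset.sum_add_distrib, Matrix.add_mulVec]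
      map_smul' := fun c v => by
        simp only [Pi.smul_apply, smul_eq_mul, mul_smul, ← Finset.smul_sum, map_smul,
          Matrix.smul_mulVec, RingHom.id_apply] }
  have L_apply : ∀ v, L v = (τ (∑ k, v k • Matrix.single k j₀ 1)).mulVec w₀ := fun v => rfl
  have hmulE : ∀ (M : Matrix (n i) (n i) ℂ) v,
      M * ∑ k, v k • Matrix.single k j₀ (1 : ℂ) = ∑ k, (M.mulVec v) k • Matrix.single k j₀ 1 := by
    intro M v
    have h : ∀ v : n i → ℂ, ∑ k, v k • Matrix.single k j₀ (1 : ℂ)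
        = Matrix.of fun a b => if b = j₀ then v a else 0 := by
      intro v
      ext a b
      simp [Matrix.sum_apply, Matrix.single_apply, ite_and, eq_comm]
    rw [h, h]
    ext a b
    simp only [Matrix.mul_apply, Matrix.of_apply, Matrix.mulVec, dotProduct]
    split_ifs <;> simp
  have L_mulVec : ∀ (M : Matrix (n i) (n i) ℂ) v, (τ M).mulVec (L v) = L (M.mulVec v) := by
    intro M v
    rw [L_apply, Matrix.mulVec_mulVec, ← τ_mul, hmulE, L_apply]
  have L_single : L (Pi.single j₀ 1) ≠ 0 := by
    rw [L_apply]
    simpa [Pi.single_apply] using hw₀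
  have L_surj : LinearMap.range L = ⊤ := by
    refine (ρ.irreducible (LinearMap.range L) ?_).resolve_left fun h => ?_
    · rintro b _ ⟨v, rfl⟩
      exact ⟨_, by rw [τ_comp, L_mulVec]⟩
    · rw [LinearMap.range_eq_bot] at h
      exact L_single (by rw [h]; rfl)
  have L_inj : LinearMap.ker L = ⊥ := by
    rw [LinearMap.ker_eq_bot']
    intro v hv
    ext k
    -- The kernel is stable under matrix units, and `e_{j₀ k}` moves the `k`-th coordinate of `v` to
    -- position `j₀`, where `L` is known to be nonzero.
    have h1 : L ((Matrix.single j₀ k 1).mulVec v) = 0 := by rw [← L_mulVec, hv]; simp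
    have h2 : (Matrix.single j₀ k 1).mulVec v = v k • Pi.single j₀ (1 : ℂ) := by
      ext l
      simp [Matrix.single_mulVec, Function.update_apply, Pi.single_apply]
    rw [h2, map_smul, smul_eq_zero] at h1
    exact h1.resolve_right L_single
  have hdeg : Fintype.card (n i) = ρ.deg := by
    simpa using LinearEquiv.finrank_eq
      (LinearEquiv.ofBijective L ⟨LinearMap.ker_eq_bot.1 L_inj, LinearMap.range_eq_top.1 L_surj⟩)
  have htr := Matrix.linear_eq_mul_trace (Matrix.traceLinearMap _ ℂ ℂ ∘ₗ τ)
    (fun M N => by simp [τ_mul, Matrix.trace_mul_comm (τ M)]) j₀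
  have hc := htr 1
  have hd : (ρ.deg : ℂ) ≠ 0 := by exact_mod_cast ρ.deg_pos.ne'
  simp only [LinearMap.comp_apply, τ_one, Matrix.traceLinearMap_apply, Matrix.trace_one,
    Fintype.card_fin, hdeg] at hc
  have hc1 : (Matrix.traceLinearMap _ ℂ ℂ ∘ₗ τ) (Matrix.single j₀ j₀ 1) = 1 :=
    (mul_right_cancel₀ hd (by rw [one_mul]; exact hc)).symm
  have h2 := htr (Φ a i)
  rw [hc1, one_mul] at h2
  rw [← h2]
  simp [IrrRep.character, τ_comp]

/-- The irreducible characters of a product of matrix algebras correspond to the factors. -/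
noncomputable def charEquiv : I ≃ IrrChar A :=
  Equiv.ofBijective (char Φ) ⟨char_injective Φ, char_surjective Φ⟩

theorem charEquiv_val (i : I) (a : A) : (charEquiv Φ i).val a = (Φ a i).trace := char_val Φ i a

theorem charEquiv_idempotent [Module.Finite ℂ A] (i : I) :
    (charEquiv Φ i).idempotent = Φ.symm (Pi.single i 1) := char_idempotent Φ i

/-! ### Block decomposition of a tensor product of algebras -/

variable {A' : Type*} [Ring A'] [Algebra ℂ A'] {J : Type*} [Fintype J] [DecidableEq J]
  {m : J → Type*} [∀ j, Fintype (m j)] [∀ j, DecidableEq (m j)] [∀ j, Nonempty (m j)]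
  (Ψ : A' ≃ₐ[ℂ] ∀ j, Matrix (m j) (m j) ℂ)

/-- The blocks of a tensor product are the tensor products of the blocks. -/
noncomputable def tensorHom :
    A ⊗[ℂ] A' →ₐ[ℂ] ∀ p : I × J, Matrix (n p.1 × m p.2) (n p.1 × m p.2) ℂ :=
  AlgHom.pi fun p => (Matrix.kroneckerAlgEquiv (n p.1) (m p.2) ℂ).toAlgHom.comp
    (Algebra.TensorProduct.map ((Pi.evalAlgHom ℂ _ p.1).comp Φ.toAlgHom)
      ((Pi.evalAlgHom ℂ _ p.2).comp Ψ.toAlgHom))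

theorem tensorHom_tmul (a : A) (b : A') (p : I × J) :
    tensorHom Φ Ψ (a ⊗ₜ b) p = ((Φ a p.1) ⊗ₖ (Ψ b p.2)) := by
  simp [tensorHom]

/-- Every matrix unit of a Kronecker block is the Kronecker product of two matrix units, hence the
image of a pure tensor. This gives surjectivity, and equality of dimensions does the rest. -/
theorem tensorHom_bijective : Function.Bijective (tensorHom Φ Ψ) := by
  have := Module.Finite.equiv Φ.symm.toLinearEquiv
  have := Module.Finite.equiv Ψ.symm.toLinearEquiv
  have hsurj : Function.Surjective (tensorHom Φ Ψ).toLinearMap := by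
    rw [← LinearMap.range_eq_top, eq_top_iff]
    rintro x -
    have hx : x = ∑ p : I × J, ∑ a, ∑ b, x p a b •
        Pi.single p (Matrix.single a b (1 : ℂ)) := by
      ext q a b
      simp only [Finset.sum_apply, Pi.smul_apply, Matrix.sum_apply, Matrix.smul_apply, smul_eq_mul]
      rw [Finset.sum_eq_single q]
      · simp [Matrix.single_apply, ite_and]
      · intro p _ hp
        simp [Pi.single_eq_of_ne hp.symm]
      · simp
    rw [hx]
    refine Submodule.sum_mem _ fun p _ => Submodule.sum_mem _ fun a _ =>
      Submodule.sum_mem _ fun b _ => Submodule.smul_mem _ _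
      ⟨Φ.symm (Pi.single p.1 (Matrix.single a.1 b.1 1)) ⊗ₜ
        Ψ.symm (Pi.single p.2 (Matrix.single a.2 b.2 1)), ?_⟩
    ext1 q
    refine (tensorHom_tmul Φ Ψ _ _ q).trans ?_
    by_cases hq : q = p
    · subst hq
      simp [Matrix.single_kronecker_single]
    · rw [Pi.single_eq_of_ne hq]
      by_cases h1 : q.1 = p.1
      · have h2 : q.2 ≠ p.2 := fun h2 => hq (Prod.ext h1 h2)
        simp [Pi.single_eq_of_ne h2]
      · simp [Pi.single_eq_of_ne h1]
  refine ⟨(LinearMap.injective_iff_surjective_of_finrank_eq_finrank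
    (f := (tensorHom Φ Ψ).toLinearMap) ?_).2 hsurj, hsurj⟩
  rw [Module.finrank_tensorProduct, Φ.toLinearEquiv.finrank_eq, Ψ.toLinearEquiv.finrank_eq,
    Module.finrank_pi_fintype, Module.finrank_pi_fintype, Module.finrank_pi_fintype,
    Finset.sum_mul_sum, Fintype.sum_prod_type]
  refine Finset.sum_congr rfl fun i _ => Finset.sum_congr rfl fun j _ => ?_
  simp only [Module.finrank_matrix, Module.finrank_self, Fintype.card_prod, mul_one]
  ring

/-- The block decomposition of a tensor product. -/
noncomputable def tensor :
    A ⊗[ℂ] A' ≃ₐ[ℂ] ∀ p : I × J, Matrix (n p.1 × m p.2) (n p.1 × m p.2) ℂ :=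
  AlgEquiv.ofBijective (tensorHom Φ Ψ) (tensorHom_bijective Φ Ψ)

theorem tensor_tmul (a : A) (b : A') (p : I × J) :
    tensor Φ Ψ (a ⊗ₜ b) p = ((Φ a p.1) ⊗ₖ (Ψ b p.2)) := tensorHom_tmul Φ Ψ a b p

theorem tensor_symm_single_one (i : I) (j : J) :
    (tensor Φ Ψ).symm (Pi.single (i, j) 1) =
      Φ.symm (Pi.single i 1) ⊗ₜ Ψ.symm (Pi.single j 1) := by
  rw [AlgEquiv.symm_apply_eq]
  ext1 q
  rw [tensor_tmul]
  obtain ⟨i', j'⟩ := q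
  by_cases h1 : i' = i
  · subst h1
    by_cases h2 : j' = j
    · subst h2; simp
    · rw [Pi.single_eq_of_ne (by simpa using h2)]
      simp [Pi.single_eq_of_ne h2]
  · rw [Pi.single_eq_of_ne (by simp [h1])]
    simp [Pi.single_eq_of_ne h1]

end BlockDecomposition

/-! ### Spectral radii of Kronecker products -/

section SpectralRadius

attribute [local instance] Matrix.frobeniusNormedRing Matrix.frobeniusNormedAlgebra

/-- The Frobenius norm serves two ends: it is an algebra norm, so Gelfand's formula applies, and it
is exactly multiplicative on Kronecker products. -/
theorem Matrix.frobenius_nnnorm_kronecker {m n : Type*} [Fintype m] [Fintype n] [DecidableEq m]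
    [DecidableEq n] (M : Matrix m m ℂ) (N : Matrix n n ℂ) :
    ‖M ⊗ₖ N‖₊ = ‖M‖₊ * ‖N‖₊ := by
  simp only [Matrix.frobenius_nnnorm_def, ← NNReal.mul_rpow]
  congr 1
  simp only [Fintype.sum_prod_type, Matrix.kronecker_apply, nnnorm_mul, NNReal.mul_rpow,
    Finset.sum_mul_sum]

theorem Matrix.kronecker_pow {m n : Type*} [Fintype m] [Fintype n] [DecidableEq m]
    [DecidableEq n] (M : Matrix m m ℂ) (N : Matrix n n ℂ) (k : ℕ) :
    (M ⊗ₖ N) ^ k = ((M ^ k) ⊗ₖ (N ^ k)) := by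
  induction k with
  | zero => simp
  | succ k ih => rw [pow_succ, ih, pow_succ, pow_succ, ← Matrix.mul_kronecker_mul]

theorem Matrix.spectralRadius_ne_top {m : Type*} [Fintype m] [DecidableEq m] (M : Matrix m m ℂ) :
    spectralRadius ℂ M ≠ ⊤ := by
  have : CompleteSpace (Matrix m m ℂ) := FiniteDimensional.complete ℂ _
  exact ne_top_of_le_ne_top (by finiteness) (spectrum.spectralRadius_le_pow_nnnorm_pow_one_div ℂ M 0)

/-- In Gelfand's formula the `k`-th term for `M ⊗ₖ N` is the product of the `k`-th terms for `M` and
`N`. Finiteness of both radii allows passing to the limit of the product in `ENNReal`. -/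
theorem Matrix.spectralRadius_kronecker {m n : Type*} [Fintype m] [Fintype n] [DecidableEq m]
    [DecidableEq n] (M : Matrix m m ℂ) (N : Matrix n n ℂ) :
    spectralRadius ℂ (M ⊗ₖ N) = spectralRadius ℂ M * spectralRadius ℂ N := by
  have : CompleteSpace (Matrix m m ℂ) := FiniteDimensional.complete ℂ _
  have : CompleteSpace (Matrix n n ℂ) := FiniteDimensional.complete ℂ _
  have : CompleteSpace (Matrix (m × n) (m × n) ℂ) := FiniteDimensional.complete ℂ _
  refine tendsto_nhds_unique
    (spectrum.pow_nnnorm_pow_one_div_tendsto_nhds_spectralRadius (M ⊗ₖ N)) ?_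
  refine (ENNReal.Tendsto.mul (spectrum.pow_nnnorm_pow_one_div_tendsto_nhds_spectralRadius M)
    (Or.inr N.spectralRadius_ne_top)
    (spectrum.pow_nnnorm_pow_one_div_tendsto_nhds_spectralRadius N)
    (Or.inr M.spectralRadius_ne_top)).congr fun k => ?_
  rw [Matrix.kronecker_pow, Matrix.frobenius_nnnorm_kronecker, ENNReal.coe_mul,
    ENNReal.mul_rpow_of_nonneg _ _ (by positivity)]

end SpectralRadius

theorem Matrix.spectralRadius_reindex {m n : Type*} [Fintype m] [Fintype n] [DecidableEq m]
    [DecidableEq n] (e : m ≃ n) (M : Matrix m m ℂ) :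
    spectralRadius ℂ (Matrix.reindex e e M) = spectralRadius ℂ M := by
  have h := AlgEquiv.spectrum_eq (Matrix.reindexAlgEquiv ℂ ℂ e) M
  simp only [spectralRadius]
  rw [← h]
  rfl

/-! ### Semisimplicity of complexified fusion rings -/

namespace FusionRing

variable {ι R : Type*} [Fintype ι] [Ring R] [StarRing R] (F : FusionRing ι R)

theorem dual_dual (i : ι) : F.dual (F.dual i) = i :=
  F.basis.injective (by rw [F.basis_dual, F.basis_dual, star_star])

/-- The unit coefficient of `a* b` is the bilinear form for which the standard basis is orthonormal.
-/
theorem repr_star_mul_unit (a b : R) :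
    F.basis.repr (star a * b) F.unit = ∑ l, F.basis.repr a l * F.basis.repr b l := by
  classical
  have h : ∀ l m, F.basis.repr (star (F.basis l) * F.basis m) F.unit = if l = m then 1 else 0 := by
    intro l m
    rw [← F.basis_dual, F.repr_unit]
    refine if_congr ⟨fun h => ?_, fun h => h ▸ rfl⟩ rfl rfl
    rw [← F.dual_dual l, h, F.dual_dual]
  conv_lhs => rw [← F.basis.sum_repr a, ← F.basis.sum_repr b]
  simp only [star_sum, star_zsmul, Finset.sum_mul_sum, smul_mul_assoc, mul_smul_comm, map_sum,
    map_smul, Finsupp.finsetSum_apply, Finsupp.smul_apply, h]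
  simp [mul_comm]

/-- Frobenius reciprocity: compare the unit coefficients of `x_k* (x_i x_j) = (x_{i*} x_k)* x_j`. -/
theorem N_dual_left (i j k : ι) : F.N (F.dual i) k j = F.N i j k := by
  classical
  have h : star (F.basis k) * (F.basis i * F.basis j) =
      star (F.basis (F.dual i) * F.basis k) * F.basis j := by
    rw [star_mul, F.basis_dual, star_star, mul_assoc]
  have h' := congrArg (fun a => F.basis.repr a F.unit) h
  simp only [repr_star_mul_unit, Module.Basis.repr_self, Finsupp.single_apply] at h'
  simpa [N] using h'.symm

theorem basisC_apply (i : ι) : F.basisC i = 1 ⊗ₜ F.basis i := by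
  simp [basisC]

theorem basisC_unit : F.basisC F.unit = 1 := by
  rw [basisC_apply, F.basis_unit]; rfl

theorem basisC_mul (i j : ι) :
    F.basisC i * F.basisC j = ∑ k, (F.N i j k : ℂ) • F.basisC k := by
  simp only [basisC_apply, Algebra.TensorProduct.tmul_mul_tmul, mul_one]
  conv_lhs => rw [← F.basis.sum_repr (F.basis i * F.basis j)]
  rw [TensorProduct.tmul_sum]
  refine Finset.sum_congr rfl fun k _ => ?_
  rw [TensorProduct.tmul_smul, TensorProduct.smul_tmul', TensorProduct.smul_tmul', N]
  simp

/-- Coordinates, in a Hermitian space. -/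
noncomputable def coords : (ℂ ⊗[ℤ] R) ≃ₗ[ℂ] EuclideanSpace ℂ ι :=
  F.basisC.equivFun.trans (WithLp.linearEquiv 2 ℂ (ι → ℂ)).symm

theorem coords_apply (a : ℂ ⊗[ℤ] R) (i : ι) : F.coords a i = F.basisC.repr a i := rfl

theorem inner_coords (a b : ℂ ⊗[ℤ] R) :
    inner ℂ (F.coords a) (F.coords b) =
      ∑ i, F.basisC.repr b i * starRingEnd ℂ (F.basisC.repr a i) := by
  simp [PiLp.inner_apply, coords_apply]

theorem repr_basisC_mul (i : ι) (a : ℂ ⊗[ℤ] R) (k : ι) :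
    F.basisC.repr (F.basisC i * a) k = ∑ j, F.basisC.repr a j * F.N i j k := by
  classical
  conv_lhs => rw [← F.basisC.sum_repr a]
  simp only [Finset.mul_sum, mul_smul_comm, basisC_mul, map_sum, map_smul,
    Finsupp.finsetSum_apply, Finsupp.smul_apply, Module.Basis.repr_self, Finsupp.single_apply]
  simp

/-- The adjoint of multiplication by a basis element is multiplication by its dual. -/
theorem inner_coords_mul (i : ι) (a b : ℂ ⊗[ℤ] R) :
    inner ℂ (F.coords a) (F.coords (F.basisC i * b)) =
      inner ℂ (F.coords (F.basisC (F.dual i) * a)) (F.coords b) := by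
  simp only [inner_coords, repr_basisC_mul, map_sum, Finset.sum_mul, Finset.mul_sum, map_mul]
  rw [Finset.sum_comm]
  refine Finset.sum_congr rfl fun j _ => Finset.sum_congr rfl fun k _ => ?_
  rw [F.N_dual_left, map_intCast (starRingEnd ℂ)]
  ring

/-- Left multiplications by basis elements are closed under adjoints, so the orthogonal complement
of a left ideal is again a left ideal. -/
theorem isSemisimpleRing {ι R : Type*} [Fintype ι] [Ring R] [StarRing R] (F : FusionRing ι R) :
    IsSemisimpleRing (ℂ ⊗[ℤ] R) := by
  have : ComplementedLattice (Submodule (ℂ ⊗[ℤ] R) (ℂ ⊗[ℤ] R)) := ⟨fun W => by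
    let K : Submodule ℂ (EuclideanSpace ℂ ι) :=
      (W.restrictScalars ℂ).map F.coords.toLinearMap
    let W₁ : Submodule ℂ (ℂ ⊗[ℤ] R) := Kᗮ.comap F.coords.toLinearMap
    have mem_W₁ : ∀ b, b ∈ W₁ ↔ ∀ a ∈ W, inner ℂ (F.coords a) (F.coords b) = 0 := by
      intro b
      change F.coords b ∈ Kᗮ ↔ _
      rw [Submodule.mem_orthogonal]
      exact Set.forall_mem_image
    have smul_mem : ∀ c b, b ∈ W₁ → c * b ∈ W₁ := by
      intro c b hb
      rw [← F.basisC.sum_repr c, Finset.sum_mul]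
      refine W₁.sum_mem fun i _ => ?_
      rw [smul_mul_assoc]
      refine W₁.smul_mem _ ((mem_W₁ _).2 fun a ha => ?_)
      rw [inner_coords_mul]
      exact (mem_W₁ b).1 hb _ (W.smul_mem _ ha)
    refine ⟨{ W₁ with smul_mem' := smul_mem }, ?_⟩
    rw [isCompl_iff, disjoint_iff, codisjoint_iff]
    constructor
    · rw [eq_bot_iff]
      rintro x ⟨hx, hx'⟩
      have h := (mem_W₁ x).1 hx' x hx
      rw [inner_self_eq_zero] at h
      exact (LinearEquiv.map_eq_zero_iff _).1 h
    · rw [eq_top_iff]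
      rintro x -
      have hx : F.coords x ∈ K ⊔ Kᗮ := by
        rw [Submodule.sup_orthogonal_of_hasOrthogonalProjection]; trivial
      obtain ⟨_, ⟨y, hy, rfl⟩, z, hz, hyz⟩ := Submodule.mem_sup.1 hx
      refine Submodule.mem_sup.2 ⟨y, hy, F.coords.symm z, ?_, ?_⟩
      · change F.coords (F.coords.symm z) ∈ Kᗮ
        rwa [LinearEquiv.apply_symm_apply]
      · apply F.coords.injective
        rw [map_add, LinearEquiv.apply_symm_apply]
        exact hyz⟩
  exact (isSemisimpleModule_iff _ _).2 this

theorem fourier_basisC (a : ℂ ⊗[ℤ] R) (i : ι) :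
    F.fourier a (F.basisC i) = F.FPdim * F.basisC.repr a (F.dual i) := by
  classical
  have h : F.fourier.flip (F.basisC i) = (F.FPdim : ℂ) • F.basisC.coord (F.dual i) := by
    refine F.basisC.ext fun k => ?_
    simp only [LinearMap.flip_apply, fourier, Module.Basis.constr_basis, LinearMap.smul_apply,
      Module.Basis.coord_apply, Module.Basis.repr_self, Finsupp.single_apply]
    congr 1
    refine if_congr ⟨fun h => ?_, fun h => ?_⟩ rfl rfl
    · rw [h, F.dual_dual]
    · rw [h, F.dual_dual]
  exact LinearMap.congr_fun h a

/-! ### Products of fusion rings -/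

section Product

variable {κ S μ T : Type*} [Fintype κ] [Ring S] [StarRing S] (G : FusionRing κ S)
  [Fintype μ] [Ring T] [StarRing T] (H : FusionRing μ T)

/-- `H` is the product of `F` and `G`, its basis being identified with pairs of basis elements. -/
structure IsProduct (s : ι × κ ≃ μ) : Prop where
  unit : s (F.unit, G.unit) = H.unit
  N : ∀ i i' k j j' l, H.N (s (i, j)) (s (i', j')) (s (k, l)) = F.N i i' k * G.N j j' l

namespace IsProduct

variable {F G H} {s : ι × κ ≃ μ} (h : IsProduct F G H s)

include h

/-- Duality can be read off from the structure constants: `x_a x_b` has unit coefficient `1` if `a =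
b*` and `0` otherwise. -/
theorem dual (i : ι) (j : κ) : s (F.dual i, G.dual j) = H.dual (s (i, j)) := by
  by_contra hne
  have h1 := h.N (F.dual i) i F.unit (G.dual j) j G.unit
  rw [h.unit] at h1
  simp only [FusionRing.N, repr_unit, if_neg hne, if_pos] at h1
  simp at h1

/-- Up to reindexing by `s`, the fusion matrix of a pair is the Kronecker product of the two fusion
matrices. -/
theorem fpdim (i : ι) (j : κ) : H.fpdim (s (i, j)) = F.fpdim i * G.fpdim j := by
  classical
  rw [FusionRing.fpdim, FusionRing.fpdim, FusionRing.fpdim, ← ENNReal.toReal_mul,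
    ← Matrix.spectralRadius_kronecker, ← Matrix.spectralRadius_reindex s]
  congr 2
  ext a b
  obtain ⟨⟨a₁, a₂⟩, rfl⟩ := s.surjective a
  obtain ⟨⟨b₁, b₂⟩, rfl⟩ := s.surjective b
  simp [h.N]

theorem FPdim : H.FPdim = F.FPdim * G.FPdim := by
  rw [FusionRing.FPdim, ← s.sum_comp, Fintype.sum_prod_type, FusionRing.FPdim, FusionRing.FPdim,
    Finset.sum_mul_sum]
  simp_rw [h.fpdim, mul_pow]

omit h in
variable (F G H s) in
/-- The identification of the bases, extended linearly. -/
noncomputable def linearEquiv : (ℂ ⊗[ℤ] R) ⊗[ℂ] (ℂ ⊗[ℤ] S) ≃ₗ[ℂ] ℂ ⊗[ℤ] T :=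
  (F.basisC.tensorProduct G.basisC).equiv H.basisC s

omit h in
theorem linearEquiv_basisC (i : ι) (j : κ) :
    linearEquiv F G H s (F.basisC i ⊗ₜ G.basisC j) = H.basisC (s (i, j)) := by
  rw [linearEquiv, ← Module.Basis.tensorProduct_apply, Module.Basis.equiv_apply]

omit h in
theorem repr_linearEquiv (a : ℂ ⊗[ℤ] R) (b : ℂ ⊗[ℤ] S) (i : ι) (j : κ) :
    H.basisC.repr (linearEquiv F G H s (a ⊗ₜ b)) (s (i, j)) =
      F.basisC.repr a i * G.basisC.repr b j := by
  change H.basisC.repr (H.basisC.repr.symm ((Finsupp.domLCongr s : _ ≃ₗ[ℂ] (μ →₀ ℂ))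
    ((F.basisC.tensorProduct G.basisC).repr (a ⊗ₜ[ℂ] b)))) _ = _
  rw [LinearEquiv.apply_symm_apply, Finsupp.domLCongr_apply, Finsupp.domCongr_apply,
    Finsupp.equivMapDomain_apply, Equiv.symm_apply_apply, Module.Basis.tensorProduct_repr_tmul_apply,
    smul_eq_mul, mul_comm]

theorem linearEquiv_mul (x y : (ℂ ⊗[ℤ] R) ⊗[ℂ] (ℂ ⊗[ℤ] S)) :
    linearEquiv F G H s (x * y) = linearEquiv F G H s x * linearEquiv F G H s y := by
  refine (LinearMap.map_mul_iff (linearEquiv F G H s).toLinearMap).2 ?_ x y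
  refine (F.basisC.tensorProduct G.basisC).ext fun p =>
    (F.basisC.tensorProduct G.basisC).ext fun q => ?_
  simp only [Module.Basis.tensorProduct_apply', LinearMap.compr₂_apply, LinearMap.mul_apply',
    LinearMap.compl₂_apply, LinearMap.comp_apply, LinearEquiv.coe_coe, linearEquiv_basisC,
    Algebra.TensorProduct.tmul_mul_tmul, basisC_mul]
  rw [← s.sum_comp, Fintype.sum_prod_type]
  simp only [h.N, TensorProduct.sum_tmul, TensorProduct.tmul_sum, map_sum]
  rw [Finset.sum_comm]
  refine Finset.sum_congr rfl fun k _ => Finset.sum_congr rfl fun l _ => ?_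
  rw [TensorProduct.smul_tmul_smul, LinearEquiv.map_smul (linearEquiv F G H s), linearEquiv_basisC]
  push_cast
  rfl

/-- The complexification of a product is the tensor product of the complexifications. -/
noncomputable def algEquiv : (ℂ ⊗[ℤ] R) ⊗[ℂ] (ℂ ⊗[ℤ] S) ≃ₐ[ℂ] ℂ ⊗[ℤ] T :=
  AlgEquiv.ofLinearEquiv (linearEquiv F G H s)
    (by rw [Algebra.TensorProduct.one_def, ← F.basisC_unit, ← G.basisC_unit, linearEquiv_basisC,
      h.unit, H.basisC_unit])
    h.linearEquiv_mul

theorem algEquiv_apply (x : (ℂ ⊗[ℤ] R) ⊗[ℂ] (ℂ ⊗[ℤ] S)) :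
    h.algEquiv x = linearEquiv F G H s x := rfl

theorem fourier (a : ℂ ⊗[ℤ] R) (b : ℂ ⊗[ℤ] S) (i : ι) (j : κ) :
    H.fourier (h.algEquiv (a ⊗ₜ b)) (H.basisC (s (i, j))) =
      F.fourier a (F.basisC i) * G.fourier b (G.basisC j) := by
  rw [fourier_basisC, fourier_basisC, fourier_basisC, ← h.dual, algEquiv_apply, repr_linearEquiv,
    h.FPdim]
  push_cast
  ring

theorem exists_irrChar_equiv :
    ∃ r : IrrChar (ℂ ⊗[ℤ] R) × IrrChar (ℂ ⊗[ℤ] S) ≃ IrrChar (ℂ ⊗[ℤ] T),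
      (∀ ρ σ i j, (r (ρ, σ)).val (H.basisC (s (i, j))) =
        ρ.val (F.basisC i) * σ.val (G.basisC j)) ∧
      ∀ ρ σ i j, H.isaacsTerm (s (i, j)) (r (ρ, σ)) = F.isaacsTerm i ρ * G.isaacsTerm j σ := by
  have := F.finite_complexification
  have := G.finite_complexification
  have := H.finite_complexification
  have := F.isSemisimpleRing
  have := G.isSemisimpleRing
  obtain ⟨n, d, hd, ⟨Φ⟩⟩ :=
    IsSemisimpleRing.exists_algEquiv_pi_matrix_of_isAlgClosed ℂ (ℂ ⊗[ℤ] R)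
  obtain ⟨m, e, he, ⟨Ψ⟩⟩ :=
    IsSemisimpleRing.exists_algEquiv_pi_matrix_of_isAlgClosed ℂ (ℂ ⊗[ℤ] S)
  -- Transporting the tensor decomposition, rather than choosing a new one for `T_ℂ`, indexes the
  -- blocks of `T_ℂ` by pairs of blocks.
  let Θ := h.algEquiv.symm.trans (BlockDecomposition.tensor Φ Ψ)
  refine ⟨((BlockDecomposition.charEquiv Φ).symm.prodCongr
    (BlockDecomposition.charEquiv Ψ).symm).trans (BlockDecomposition.charEquiv Θ), ?_, ?_⟩
  · intro ρ σ i j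
    obtain ⟨p, rfl⟩ := (BlockDecomposition.charEquiv Φ).surjective ρ
    obtain ⟨q, rfl⟩ := (BlockDecomposition.charEquiv Ψ).surjective σ
    simp only [Equiv.trans_apply, Equiv.prodCongr_apply, Prod.map_apply, Equiv.symm_apply_apply,
      BlockDecomposition.charEquiv_val]
    rw [← linearEquiv_basisC (F := F) (G := G), ← h.algEquiv_apply, AlgEquiv.trans_apply,
      AlgEquiv.symm_apply_apply, BlockDecomposition.tensor_tmul, Matrix.trace_kronecker]
  · intro ρ σ i j
    obtain ⟨p, rfl⟩ := (BlockDecomposition.charEquiv Φ).surjective ρ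
    obtain ⟨q, rfl⟩ := (BlockDecomposition.charEquiv Ψ).surjective σ
    simp only [Equiv.trans_apply, Equiv.prodCongr_apply, Prod.map_apply, Equiv.symm_apply_apply,
      isaacsTerm, omega, classSum, BlockDecomposition.charEquiv_idempotent, h.fpdim]
    have hΘ : Θ.symm (Pi.single (p, q) 1) =
        h.algEquiv (Φ.symm (Pi.single p 1) ⊗ₜ Ψ.symm (Pi.single q 1)) := by
      rw [← BlockDecomposition.tensor_symm_single_one]
      rfl
    rw [hΘ, h.fourier, Complex.ofReal_mul, mul_div_mul_comm]

theorem isaacsTerms : H.isaacsTerms = Set.image2 (· * ·) F.isaacsTerms G.isaacsTerms := by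
  obtain ⟨r, -, hr⟩ := h.exists_irrChar_equiv
  ext t
  constructor
  · rintro ⟨k, χ, rfl⟩
    obtain ⟨⟨i, j⟩, rfl⟩ := s.surjective k
    obtain ⟨⟨ρ, σ⟩, rfl⟩ := r.surjective χ
    exact ⟨_, ⟨i, ρ, rfl⟩, _, ⟨j, σ, rfl⟩, (hr ρ σ i j).symm⟩
  · rintro ⟨_, ⟨i, ρ, rfl⟩, _, ⟨j, σ, rfl⟩, rfl⟩
    exact ⟨s (i, j), r (ρ, σ), hr ρ σ i j⟩

theorem isIsaacs (hF : F.IsIsaacs) (hG : G.IsIsaacs) : H.IsIsaacs := by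
  obtain ⟨r, -, hr⟩ := h.exists_irrChar_equiv
  intro k χ
  obtain ⟨⟨i, j⟩, rfl⟩ := s.surjective k
  obtain ⟨⟨ρ, σ⟩, rfl⟩ := r.surjective χ
  rw [hr]
  exact (hF i ρ).mul (hG j σ)

end IsProduct

end Product

end FusionRing

/-! ### Exactness of functors on fusion categories -/

section Semisimple

attribute [local instance] Abelian.hasFiniteBiproducts

namespace FusionCategory

variable {C : Type u} [Category.{v} C] [Abelian C] [Linear ℂ C] [MonoidalCategory C]
  [MonoidalPreadditive C] [MonoidalLinear ℂ C] [RigidCategory C] [FusionCategory C]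

/-- A nonzero map out of a sum of simples is nonzero on some summand, and by Schur's lemma it is an
isomorphism there; its inverse is the section. -/
theorem exists_section_of_simple {P S : C} [Simple S] (p : P ⟶ S) [Epi p] :
    ∃ q : S ⟶ P, q ≫ p = 𝟙 S := by
  obtain ⟨n, T, hT, ⟨e⟩⟩ := semisimple P
  have hp : p ≠ 0 := fun h => id_nonzero S ((cancel_epi p).1 (by simp [h]))
  obtain ⟨j, hj⟩ : ∃ j, biproduct.ι T j ≫ e.inv ≫ p ≠ 0 := by
    by_contra! h
    apply hp
    rw [← cancel_epi e.inv]
    exact biproduct.hom_ext' _ _ fun j => by rw [h j]; simp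
  have := hT j
  have := isIso_of_hom_simple hj
  exact ⟨inv (biproduct.ι T j ≫ e.inv ≫ p) ≫ biproduct.ι T j ≫ e.inv, by
    simp only [Category.assoc, IsIso.inv_hom_id]⟩

/-- To lift `f` through an epimorphism, pull the epimorphism back along `f` and split the resulting
epimorphism onto `S`. -/
theorem projective_of_simple (S : C) [Simple S] : Projective S where
  factors f e _ := by
    obtain ⟨q, hq⟩ := exists_section_of_simple (pullback.fst f e)
    exact ⟨q ≫ pullback.snd f e, by
      rw [Category.assoc, ← pullback.condition, reassoc_of% hq]⟩

theorem projective (X : C) : Projective X := by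
  obtain ⟨n, T, hT, ⟨e⟩⟩ := semisimple X
  have : ∀ j, Projective (T j) := fun j => haveI := hT j; projective_of_simple (T j)
  refine Projective.of_iso e.symm ⟨fun f p _ =>
    ⟨biproduct.desc fun j => Projective.factorThru (biproduct.ι T j ≫ f) p, ?_⟩⟩
  exact biproduct.hom_ext' _ _ fun j => by simp

/-- All short exact sequences split because every object is projective, and additive functors
preserve splittings. The right exactness required by the universal property is thus automatic here.
-/
theorem preservesFiniteColimits {A : Type*} [Category* A] [Abelian A] (F : C ⥤ A) [F.Additive] :
    PreservesFiniteColimits F :=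
  (F.preservesFiniteColimits_tfae.out 0 3).1 fun S hS => by
    have := projective S.X₃
    let s := hS.splittingOfProjective.map F
    exact ⟨s.exact, s.epi_g⟩

theorem isLinearRightExact_coyoneda (Z : C) :
    IsLinearRightExact ((linearCoyoneda ℂ C).obj (Opposite.op Z)) where
  additive := inferInstance
  linear.map_smul f r := by
    ext : 1
    exact LinearMap.ext fun g => Linear.comp_smul _ _ _ g r f
  rightExact := preservesFiniteColimits _

theorem hd_map_biproduct {D : Type u₂} [Category.{v} D] [Abelian D] [Linear ℂ D]
    [MonoidalCategory D] [MonoidalPreadditive D] [MonoidalLinear ℂ D] [RigidCategory D]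
    [FusionCategory D] (Z : C) (F : D ⥤ C) [F.Additive] {n : ℕ} (S : Fin n → D) :
    hd Z (F.obj (⨁ S)) = ∑ k, hd Z (F.obj (S k)) := by
  rw [hd_congr_right _ (F.mapBiproduct S), hd_biproduct_right]
  rfl

end FusionCategory

end Semisimple

/-! ### Simple objects of the Deligne tensor product -/

section Deligne

open FusionCategory

variable {C : Type u₁} [Category.{v} C] [Abelian C] [Linear ℂ C]
  {D : Type u₂} [Category.{v} D] [Abelian D] [Linear ℂ D]

/-- The bifunctor `(X', Y') ↦ Hom(X, X') ⊗ Hom(Y, Y')`. -/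
def homTensor (X : C) (Y : D) : C × D ⥤ ModuleCat.{v} ℂ where
  obj W := ModuleCat.of ℂ ((X ⟶ W.1) ⊗[ℂ] (Y ⟶ W.2))
  map f := ModuleCat.ofHom
    (TensorProduct.map (Linear.rightComp ℂ X f.1) (Linear.rightComp ℂ Y f.2))
  map_id W := by
    ext : 1
    refine TensorProduct.ext' fun f g => ?_
    simp
  map_comp f g := by
    ext : 1
    refine TensorProduct.ext' fun f g => ?_
    simp

namespace IsBilinearRightExact

variable {A : Type u} [Category.{v} A] [Abelian A] [Linear ℂ A] {B : C × D ⥤ A}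
  (h : IsBilinearRightExact B)

include h

omit h in
theorem map_mkHom {X X' : C} {Y Y' : D} (f : X ⟶ X') (g : Y ⟶ Y') :
    B.map (f ×ₘ g) = B.map (f ×ₘ 𝟙 Y) ≫ B.map (𝟙 X' ×ₘ g) := by
  rw [← B.map_comp]
  simp

theorem map_add_left {X X' : C} {Y Y' : D} (f f' : X ⟶ X') (g : Y ⟶ Y') :
    B.map ((f + f') ×ₘ g) = B.map (f ×ₘ g) + B.map (f' ×ₘ g) := by
  have e : B.map ((f + f') ×ₘ 𝟙 Y) = B.map (f ×ₘ 𝟙 Y) + B.map (f' ×ₘ 𝟙 Y) :=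
    (h.additive_left Y).map_add
  rw [map_mkHom, map_mkHom f, map_mkHom f', e, Preadditive.add_comp]

theorem map_add_right {X X' : C} {Y Y' : D} (f : X ⟶ X') (g g' : Y ⟶ Y') :
    B.map (f ×ₘ (g + g')) = B.map (f ×ₘ g) + B.map (f ×ₘ g') := by
  have e : B.map (𝟙 X' ×ₘ (g + g')) = B.map (𝟙 X' ×ₘ g) + B.map (𝟙 X' ×ₘ g') :=
    (h.additive_right X').map_add
  rw [map_mkHom, map_mkHom f g, map_mkHom f g', e, Preadditive.comp_add]

theorem map_smul_left {X X' : C} {Y Y' : D} (c : ℂ) (f : X ⟶ X') (g : Y ⟶ Y') :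
    B.map ((c • f) ×ₘ g) = c • B.map (f ×ₘ g) := by
  have := h.additive_left Y
  have e : B.map ((c • f) ×ₘ 𝟙 Y) = c • B.map (f ×ₘ 𝟙 Y) :=
    (h.linear_left Y).map_smul f c
  rw [map_mkHom, map_mkHom f, e, Linear.smul_comp]

theorem map_smul_right {X X' : C} {Y Y' : D} (c : ℂ) (f : X ⟶ X') (g : Y ⟶ Y') :
    B.map (f ×ₘ (c • g)) = c • B.map (f ×ₘ g) := by
  have := h.additive_right X'
  have e : B.map (𝟙 X' ×ₘ (c • g)) = c • B.map (𝟙 X' ×ₘ g) :=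
    (h.linear_right X').map_smul g c
  rw [map_mkHom, map_mkHom f g, e, Linear.comp_smul]

/-- The bilinear Yoneda transformation sending `𝟙 ⊗ 𝟙` to `𝟙`. -/
def yonedaHom (X : C) (Y : D) :
    homTensor X Y ⟶ B ⋙ (linearCoyoneda ℂ A).obj (Opposite.op (B.obj (X, Y))) where
  app W := ModuleCat.ofHom (TensorProduct.lift (LinearMap.mk₂ ℂ
    (fun (f : X ⟶ W.1) (g : Y ⟶ W.2) => (B.map (f ×ₘ g) : B.obj (X, Y) ⟶ B.obj (W.1, W.2)))
    (fun _ _ _ => h.map_add_left _ _ _) (fun _ _ _ => h.map_smul_left _ _ _)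
    (fun _ _ _ => h.map_add_right _ _ _) (fun _ _ _ => h.map_smul_right _ _ _)))
  naturality W W' a := by
    ext : 1
    refine TensorProduct.ext' fun f g => ?_
    exact B.map_comp (f ×ₘ g) (a.1 ×ₘ a.2)

theorem yonedaHom_app_one (X : C) (Y : D) :
    (h.yonedaHom X Y).app (X, Y) (𝟙 X ⊗ₜ[ℂ] 𝟙 Y) = 𝟙 (B.obj (X, Y)) :=
  B.map_id (X, Y)

end IsBilinearRightExact

end Deligne

section DeligneFusion

open FusionCategory

variable {C : Type u₁} [Category.{v} C] [Abelian C] [Linear ℂ C] [MonoidalCategory C]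
  [MonoidalPreadditive C] [MonoidalLinear ℂ C] [RigidCategory C] [FusionCategory C]
  {D : Type u₂} [Category.{v} D] [Abelian D] [Linear ℂ D] [MonoidalCategory D]
  [MonoidalPreadditive D] [MonoidalLinear ℂ D] [RigidCategory D] [FusionCategory D]

theorem homTensor_bilinear (X : C) (Y : D) : IsBilinearRightExact (homTensor X Y) := by
  have hL : ∀ Y', (Prod.sectL C Y' ⋙ homTensor X Y).Additive := fun Y' =>
    { map_add := fun {_ _} a b => by
        ext : 1
        refine TensorProduct.ext' fun f g => ?_
        change (f ≫ (a + b)) ⊗ₜ[ℂ] (g ≫ 𝟙 _) =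
          (f ≫ a) ⊗ₜ[ℂ] (g ≫ 𝟙 _) + (f ≫ b) ⊗ₜ[ℂ] (g ≫ 𝟙 _)
        exact (congrArg (· ⊗ₜ[ℂ] _) (Preadditive.comp_add _ _ _ f a b)).trans
          (TensorProduct.add_tmul _ _ _) }
  have hR : ∀ X', (Prod.sectR X' D ⋙ homTensor X Y).Additive := fun X' =>
    { map_add := fun {_ _} a b => by
        ext : 1
        refine TensorProduct.ext' fun f g => ?_
        change (f ≫ 𝟙 _) ⊗ₜ[ℂ] (g ≫ (a + b)) =
          (f ≫ 𝟙 _) ⊗ₜ[ℂ] (g ≫ a) + (f ≫ 𝟙 _) ⊗ₜ[ℂ] (g ≫ b)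
        exact (congrArg (_ ⊗ₜ[ℂ] ·) (Preadditive.comp_add _ _ _ g a b)).trans
          (TensorProduct.tmul_add _ _ _) }
  exact
    { additive_left := hL
      linear_left := fun Y' =>
        { map_smul := fun {_ _} a r => by
            ext : 1
            refine TensorProduct.ext' fun f g => ?_
            change (f ≫ (r • a)) ⊗ₜ[ℂ] (g ≫ 𝟙 _) = r • ((f ≫ a) ⊗ₜ[ℂ] (g ≫ 𝟙 _))
            exact congrArg (· ⊗ₜ[ℂ] _) (Linear.comp_smul _ _ _ f r a) }
      rightExact_left := fun Y' => preservesFiniteColimits _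
      additive_right := hR
      linear_right := fun X' =>
        { map_smul := fun {_ _} a r => by
            ext : 1
            refine TensorProduct.ext' fun f g => ?_
            change (f ≫ 𝟙 _) ⊗ₜ[ℂ] (g ≫ (r • a)) = r • ((f ≫ 𝟙 _) ⊗ₜ[ℂ] (g ≫ a))
            exact (congrArg (_ ⊗ₜ[ℂ] ·) (Linear.comp_smul _ _ _ g r a)).trans
              (TensorProduct.tmul_smul _ _ _) }
      rightExact_right := fun X' => preservesFiniteColimits _ }

variable {E : Type u₃} [Category.{v} E] [Abelian E] [Linear ℂ E] [MonoidalCategory E]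
  [MonoidalPreadditive E] [MonoidalLinear ℂ E] [RigidCategory E] [FusionCategory E]

namespace IsDeligneTensorProduct

variable {B : C × D ⥤ E} (hB : IsDeligneTensorProduct B)

include hB

/-- Let `G` extend `Hom(X, -) ⊗ Hom(Y, -)` to `E`. The bilinear Yoneda map extends to `β : G ⟶ Hom(X
⊠ Y, -)`, and some `x` in `G(X ⊠ Y)` has `β x = 𝟙`. Naturality gives `β (G(f) x) = f`, so `f ↦ G(f)
x` embeds `Hom(X ⊠ Y, X' ⊠ Y')` into the tensor product. Equality is not needed at this stage. -/
theorem hd_obj_le (X X' : C) (Y Y' : D) :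
    hd (B.obj (X, Y)) (B.obj (X', Y')) ≤ hd X X' * hd Y Y' := by
  obtain ⟨G, hG, ⟨φ⟩⟩ := hB.exists_lift (ModuleCat.{v} ℂ) _ (homTensor_bilinear X Y)
  obtain ⟨β, hβ, -⟩ := hB.existsUnique_hom (ModuleCat.{v} ℂ) G _ hG
    (isLinearRightExact_coyoneda (B.obj (X, Y))) (φ.hom ≫ hB.bilinear.yonedaHom X Y)
  have := hG.additive
  have := hG.linear
  -- The candidate universal element of `G`, corresponding to `𝟙 ⊗ 𝟙`.
  let x : G.obj (B.obj (X, Y)) := φ.inv.app (X, Y) (𝟙 X ⊗ₜ[ℂ] 𝟙 Y)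
  have hx : β.app (B.obj (X, Y)) x = 𝟙 (B.obj (X, Y)) := by
    have h1 : β.app (B.obj (X, Y)) = φ.hom.app (X, Y) ≫ (hB.bilinear.yonedaHom X Y).app (X, Y) :=
      congrArg (fun t => t.app (X, Y)) hβ
    have h2 : φ.hom.app (X, Y) x = 𝟙 X ⊗ₜ[ℂ] 𝟙 Y :=
      congrArg (fun t => t.hom (𝟙 X ⊗ₜ[ℂ] 𝟙 Y)) (φ.inv_hom_id_app (X, Y))
    exact (congrArg (fun t => t.hom x) h1).trans
      ((congrArg ((hB.bilinear.yonedaHom X Y).app (X, Y)).hom h2).trans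
        (hB.bilinear.yonedaHom_app_one X Y))
  let L : (B.obj (X, Y) ⟶ B.obj (X', Y')) →ₗ[ℂ] ((X ⟶ X') ⊗[ℂ] (Y ⟶ Y')) :=
    { toFun := fun f => φ.hom.app (X', Y') (G.map f x)
      map_add' := fun f g => by
        rw [G.map_add]
        exact map_add (φ.hom.app (X', Y')).hom _ _
      map_smul' := fun c f => by
        rw [G.map_smul]
        exact map_smul (φ.hom.app (X', Y')).hom c _ }
  have hL : Function.Injective L := by
    have key : ∀ f : B.obj (X, Y) ⟶ B.obj (X', Y'),
        β.app (B.obj (X', Y')) (φ.inv.app (X', Y') (L f)) = f := by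
      intro f
      have h1 : φ.inv.app (X', Y') (L f) = G.map f x :=
        congrArg (fun t => t.hom (G.map f x)) (φ.hom_inv_id_app (X', Y'))
      have h2 := congrArg (fun t => t x) (congrArg ModuleCat.Hom.hom (β.naturality f))
      rw [h1]
      refine h2.trans ?_
      change β.app (B.obj (X, Y)) x ≫ f = f
      rw [hx, Category.id_comp]
    exact fun f g h => by rw [← key f, ← key g, h]
  have := LinearMap.finrank_le_finrank_of_injective hL
  rw [Module.finrank_tensorProduct] at this
  unfold hd
  exact_mod_cast this

/-- The extension of `Hom(X, -) ⊗ Hom(Y, -)` to `E` takes at `X ⊠ Y` the one-dimensional value `End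
X ⊗ End Y`, whereas an additive functor kills zero objects. -/
theorem id_obj_ne_zero (X : C) (Y : D) [Simple X] [Simple Y] : 𝟙 (B.obj (X, Y)) ≠ 0 := by
  intro h
  obtain ⟨G, hG, ⟨φ⟩⟩ := hB.exists_lift (ModuleCat.{v} ℂ) _ (homTensor_bilinear X Y)
  have := hG.additive
  have h1 : 𝟙 ((homTensor X Y).obj (X, Y)) = 0 := by
    have h2 : 𝟙 (G.obj (B.obj (X, Y))) = 0 := by rw [← G.map_id, h, G.map_zero]
    have h3 : φ.inv.app (X, Y) = 0 :=
      (Category.comp_id (φ.inv.app (X, Y))).symm.trans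
        ((congrArg (φ.inv.app (X, Y) ≫ ·) h2).trans comp_zero)
    rw [← φ.inv_hom_id_app, h3, zero_comp]
  have h4 : Subsingleton ((X ⟶ X) ⊗[ℂ] (Y ⟶ Y)) :=
    ModuleCat.subsingleton_of_isZero ((IsZero.iff_id_eq_zero _).2 h1)
  have h5 : Module.finrank ℂ ((X ⟶ X) ⊗[ℂ] (Y ⟶ Y)) = 0 := Module.finrank_zero_of_subsingleton
  rw [Module.finrank_tensorProduct, finrank_endomorphism_simple_eq_one,
    finrank_endomorphism_simple_eq_one] at h5
  exact one_ne_zero h5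

theorem simple_obj (X : C) (Y : D) [Simple X] [Simple Y] : Simple (B.obj (X, Y)) := by
  classical
  refine simple_of_hd (le_antisymm ?_ ?_)
  · refine (hB.hd_obj_le X X Y Y).trans ?_
    rw [hd_simple, hd_simple, if_pos ⟨Iso.refl _⟩, if_pos ⟨Iso.refl _⟩, one_mul]
  · have : Nontrivial (B.obj (X, Y) ⟶ B.obj (X, Y)) := ⟨_, _, hB.id_obj_ne_zero X Y⟩
    have := Module.finrank_pos (R := ℂ) (M := B.obj (X, Y) ⟶ B.obj (X, Y))
    unfold hd
    omega

/-- The class of `X ⊠ Y`. -/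
noncomputable def irrMap (p : Irr C × Irr D) : Irr E :=
  haveI := hB.simple_obj p.1.rep p.2.rep
  Irr.mk (B.obj (p.1.rep, p.2.rep))

theorem irrMap_rep (i : Irr C) (j : Irr D) :
    Nonempty ((hB.irrMap (i, j)).rep ≅ B.obj (i.rep, j.rep)) :=
  haveI := hB.simple_obj i.rep j.rep
  rep_mk_iso _

theorem irrMap_injective : Function.Injective hB.irrMap := by
  classical
  rintro ⟨i, j⟩ ⟨i', j'⟩ h
  have := hB.simple_obj i.rep j.rep
  have := hB.simple_obj i'.rep j'.rep
  -- Isomorphic images make the left side `1`, so neither Kronecker delta on the right may vanish.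
  have h1 := hB.hd_obj_le i.rep i'.rep j.rep j'.rep
  rw [hd_simple (B.obj _), if_pos ((mk_eq_iff _ _).1 h), hd_rep_simple, hd_rep_simple, mk_rep,
    mk_rep] at h1
  by_cases hi : i = i'
  · by_cases hj : j = j'
    · rw [hi, hj]
    · simp [hj] at h1
  · simp [hi] at h1

theorem hd_obj_eq_sum (Z : E) (X : C) (Y : D) :
    hd Z (B.obj (X, Y)) =
      ∑ k : Irr C, ∑ l : Irr D, hd k.rep X * (hd l.rep Y * hd Z (B.obj (k.rep, l.rep))) := by
  have h1 : hd Z (B.obj (X, Y)) = ∑ k : Irr C, hd k.rep X * hd Z (B.obj (k.rep, Y)) := by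
    have := hB.bilinear.additive_left Y
    exact additive_eq_sum (fun X => hd Z ((Prod.sectL C Y ⋙ B).obj X))
      (fun _ _ e => hd_congr_right _ ((Prod.sectL C Y ⋙ B).mapIso e))
      (fun n S => hd_map_biproduct Z _ S) X
  have h2 : ∀ k : Irr C, hd Z (B.obj (k.rep, Y)) =
      ∑ l : Irr D, hd l.rep Y * hd Z (B.obj (k.rep, l.rep)) := fun k => by
    have := hB.bilinear.additive_right k.rep
    exact additive_eq_sum (fun Y => hd Z ((Prod.sectR k.rep D ⋙ B).obj Y))
      (fun _ _ e => hd_congr_right _ ((Prod.sectR k.rep D ⋙ B).mapIso e))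
      (fun n S => hd_map_biproduct Z _ S) Y
  rw [h1]
  refine Finset.sum_congr rfl fun k _ => ?_
  rw [h2, Finset.mul_sum]

/-- The objects `X ⊠ Y` detect natural transformations between right exact linear functors. If `z`
were missed, `Hom(z, -)` would vanish on all of them, so its identity and zero endomorphisms would
coincide. -/
theorem irrMap_surjective : Function.Surjective hB.irrMap := by
  classical
  intro z
  by_contra! hz
  have h0 : ∀ (X : C) (Y : D), hd z.rep (B.obj (X, Y)) = 0 := by
    intro X Y
    rw [hB.hd_obj_eq_sum]
    refine Finset.sum_eq_zero fun k _ => Finset.sum_eq_zero fun l _ => ?_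
    have := hB.simple_obj k.rep l.rep
    rw [hd_rep_simple z, if_neg fun h => hz (k, l) h.symm, mul_zero, mul_zero]
  have hH := isLinearRightExact_coyoneda z.rep
  obtain ⟨β, -, hβ⟩ := hB.existsUnique_hom (ModuleCat.{v} ℂ) _ _ hH hH 0
  have h1 := (hβ (𝟙 _) ?_).trans (hβ 0 rfl).symm
  · have h2 : (𝟙 z.rep : z.rep ⟶ z.rep) = 0 :=
      congrArg (fun t => (t.app z.rep).hom (𝟙 z.rep)) h1
    exact id_nonzero _ h2
  · ext ⟨X, Y⟩ f
    have h2 : Subsingleton (z.rep ⟶ B.obj (X, Y)) :=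
      Module.finrank_zero_iff.1 (Int.natCast_eq_zero.1 (h0 X Y))
    exact h2.elim _ _

/-- `(X, Y) ↦ X ⊠ Y` is a bijection on isomorphism classes of simple objects. -/
noncomputable def irrEquiv : Irr C × Irr D ≃ Irr E :=
  Equiv.ofBijective hB.irrMap ⟨hB.irrMap_injective, hB.irrMap_surjective⟩

theorem irrEquiv_rep (i : Irr C) (j : Irr D) :
    Nonempty ((hB.irrEquiv (i, j)).rep ≅ B.obj (i.rep, j.rep)) := hB.irrMap_rep i j

/-- Once the simple objects are known, biadditivity of `B` reduces the multiplicity to simple `X`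
and `Y`, where it is a product of Kronecker deltas. -/
theorem hd_irrEquiv_rep (i : Irr C) (j : Irr D) (X : C) (Y : D) :
    hd (hB.irrEquiv (i, j)).rep (B.obj (X, Y)) = hd i.rep X * hd j.rep Y := by
  classical
  have h : ∀ k l, hd (hB.irrEquiv (i, j)).rep (B.obj (Irr.rep k, Irr.rep l)) =
      if k = i then if l = j then 1 else 0 else 0 := by
    intro k l
    have := hB.simple_obj k.rep l.rep
    rw [hd_rep_simple, ← ite_and]
    refine if_congr ?_ rfl rfl
    rw [← Prod.mk_inj, ← hB.irrEquiv.injective.eq_iff]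
    exact eq_comm
  rw [hB.hd_obj_eq_sum]
  simp [h]

/-- The monoidal structure supplies `𝟙 ≅ 𝟙 ⊠ 𝟙` and `(X ⊠ Y) ⊗ (X' ⊠ Y') ≅ (X ⊗ X') ⊠ (Y ⊗ Y')`;
multiplicities in the latter object factor. -/
theorem isProduct [B.Monoidal] :
    FusionRing.IsProduct (K0.fusionRing C) (K0.fusionRing D) (K0.fusionRing E) hB.irrEquiv where
  unit := by
    obtain ⟨a⟩ := rep_mk_iso (𝟙_ C)
    obtain ⟨b⟩ := rep_mk_iso (𝟙_ D)
    have : Simple (B.obj (((K0.fusionRing C).unit, (K0.fusionRing D).unit).1.rep,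
        ((K0.fusionRing C).unit, (K0.fusionRing D).unit).2.rep)) := hB.simple_obj _ _
    exact (mk_eq_iff _ _).2
      ⟨(B.mapIso (Iso.prod a b)).trans (Functor.Monoidal.εIso B).symm⟩
  N i i' k j j' l := by
    obtain ⟨e⟩ := hB.irrEquiv_rep i j
    obtain ⟨e'⟩ := hB.irrEquiv_rep i' j'
    refine (K0.basis_mul_basis _ _ _).trans ?_
    refine Eq.trans ?_ (congrArg₂ (· * ·) (K0.basis_mul_basis i i' k)
      (K0.basis_mul_basis j j' l)).symm
    rw [mult, hd_congr_right _ ((tensorIso e e').trans (Functor.Monoidal.μIso B _ _))]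
    exact hB.hd_irrEquiv_rep k l _ _

end IsDeligneTensorProduct

end DeligneFusion

theorem lemma4p11
    {C : Type u₁} [Category.{v} C] [Abelian C] [Linear ℂ C] [MonoidalCategory C]
    [MonoidalPreadditive C] [MonoidalLinear ℂ C] [RigidCategory C]
    [FusionCategory C] [SphericalCategory C]
    {D : Type u₂} [Category.{v} D] [Abelian D] [Linear ℂ D] [MonoidalCategory D]
    [MonoidalPreadditive D] [MonoidalLinear ℂ D] [RigidCategory D]
    [FusionCategory D] [SphericalCategory D]
    {E : Type u₃} [Category.{v} E] [Abelian E] [Linear ℂ E] [MonoidalCategory E]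
    [MonoidalPreadditive E] [MonoidalLinear ℂ E] [RigidCategory E]
    [FusionCategory E]
    (B : C × D ⥤ E) [B.Monoidal] (hB : IsDeligneTensorProduct B) :
    (∃ (s : Irr C × Irr D ≃ Irr E)
      (r : IrrChar (ℂ ⊗[ℤ] K0 C) × IrrChar (ℂ ⊗[ℤ] K0 D) ≃ IrrChar (ℂ ⊗[ℤ] K0 E)),
      (∀ i j, Nonempty ((s (i, j)).rep ≅ B.obj (i.rep, j.rep))) ∧
      (∀ ρ σ i j, (r (ρ, σ)).val ((K0.fusionRing E).basisC (s (i, j))) =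
        ρ.val ((K0.fusionRing C).basisC i) * σ.val ((K0.fusionRing D).basisC j)) ∧
      ∀ ρ σ i j, (K0.fusionRing E).isaacsTerm (s (i, j)) (r (ρ, σ)) =
        (K0.fusionRing C).isaacsTerm i ρ * (K0.fusionRing D).isaacsTerm j σ) ∧
    (K0.fusionRing E).isaacsTerms =
      Set.image2 (· * ·) (K0.fusionRing C).isaacsTerms (K0.fusionRing D).isaacsTerms ∧
    ((K0.fusionRing C).IsIsaacs → (K0.fusionRing D).IsIsaacs → (K0.fusionRing E).IsIsaacs) := by
  obtain ⟨r, hr, hr'⟩ := hB.isProduct.exists_irrChar_equiv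
  exact ⟨⟨hB.irrEquiv, r, hB.irrEquiv_rep, hr, hr'⟩, hB.isProduct.isaacsTerms,
    hB.isProduct.isIsaacs⟩
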